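/- **Lerch function.** For $s,v\in\mathbb C$ let $z\mapsto\Phi(z,s,v)$ be the analytic continuation to $\mathbb C\setminus[1,\infty)$ of the function given on $|z|<1$ by $\sum_{j\ge 0}(v+j)^{-s}z^j$. All logarithms, arguments and powers are principal ($-\pi<\arg\le\pi$). (If $-s$ is a nonnegative integer, the coefficients are polynomials in $v$, with $0^0=1$, and every $v$ is allowed; in the other cases below, $v\ne 0,-1,-2,\dots$ automatically.) **Theorem.** Let $a,k,l,n\in\mathbb C$ with $a\neq0$ and $0<\operatorname{Re}(2n+1)<2\operatorname{Re}(l)$. Put $$z_n=e^{i(2\pi n+\pi)/l},\qquad v=1-\frac{i\,l\log a}{2\pi},$$ and assume that one of the following holds: 1. $k$ is a nonnegative integer and $z_n\notin[1,\infty)$; or 2. $0\le\arg a\le\pi$; $\operatorname{Re}k>-1$ if $a>0$; and $|z_n|<1$ or $0<\operatorname{Re}\frac{2n+1}{l}<2$ (this last alternative is automatic when $l$ is real). Then the integral below converges absolutely and $$\int_0^\infty\frac{x^{2n}\log(x)\,\log^k(ax^2)}{x^{2l}-1}\,dx=-\frac{2^{k-1}\pi^{k+1}\left(\frac il\right)^k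 e^{i(2\pi n+\pi)/l}}{l^2}\Bigl(2\pi\,\Phi(z_n,-k-1,v)+i\,l\log(a)\,\Phi(z_n,-k,v)\Bigr).$$ Moreover, if $m\in\mathbb C$ is such that $(a,k,l,m)$ satisfies the same conditions as $(a,k,l,n)$, then, with $z_m=e^{i(2\pi m+\pi)/l}$, the following integral also converges absolutely and $$\int_0^\infty\frac{\log(x)\,(x^{2m}+x^{2n})\log^k(ax^2)}{x^{2l}-1}\,dx=-\frac{2^{k-1}\pi^{k+1}e^{i\pi/l}\left(\frac il\right)^k}{l^2}\Bigl(e^{2\pi i m/l}\bigl(2\pi\,\Phi(z_m,-k-1,v)+i\,l\log(a)\,\Phi(z_m,-k,v)\bigr)+e^{2\pi i n/l}\bigl(2\pi\,\Phi(z_n,-k-1,v)+i\,l\log(a)\,\Phi(z_n,-k,v)\bigr)\Bigr).$$ -/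

import Mathlib

open MeasureTheory Set

/-- The slit plane `ℂ ∖ [1, ∞)`. -/
def lerchDomain : Set ℂ := {z | 1 - z ∈ Complex.slitPlane}

/-- `F` is holomorphic on `ℂ ∖ [1, ∞)` and equals `∑ (v + j)^(-s) z^j` (principal powers) on the
open unit disc. -/
def IsLerchContinuation (s v : ℂ) (F : ℂ → ℂ) : Prop :=
  DifferentiableOn ℂ F lerchDomain ∧
    ∀ z : ℂ, ‖z‖ < 1 → HasSum (fun j : ℕ => (v + j) ^ (-s) * z ^ j) (F z)

open Classical in
/-- The Lerch function `Φ(z, s, v)`: the analytic continuation in `z` of `∑ (v + j)^(-s) z^j`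
from the unit disc to `ℂ ∖ [1, ∞)` (unique there, see `lerchPhi_eq`). -/
noncomputable def lerchPhi (z s v : ℂ) : ℂ :=
  if h : ∃ F, IsLerchContinuation s v F then h.choose z else 0

theorem ball_subset_lerchDomain : Metric.ball (0 : ℂ) 1 ⊆ lerchDomain := by
  intro z hz
  have h1 : ‖z‖ < 1 := by simpa using hz
  have h2 := (Complex.abs_re_le_norm z).trans_lt h1
  left
  have := (abs_lt.1 h2).2
  simp only [Complex.sub_re, Complex.one_re]
  linarith

theorem lerchDomain_isOpen : IsOpen lerchDomain :=
  Complex.isOpen_slitPlane.preimage (by fun_prop : Continuous fun z : ℂ => 1 - z)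

theorem lerchDomain_isPreconnected : IsPreconnected lerchDomain := by
  have h : lerchDomain = (fun z : ℂ => 1 - z) '' Complex.slitPlane := by
    ext z
    constructor
    · intro hz
      exact ⟨1 - z, hz, by ring⟩
    · rintro ⟨w, hw, rfl⟩
      simpa [lerchDomain] using hw
  rw [h]
  exact (Complex.starConvex_one_slitPlane.isPathConnected
    Complex.one_mem_slitPlane).isConnected.isPreconnected.image _
    (by fun_prop : Continuous fun z : ℂ => 1 - z).continuousOn

/-- The continuation is unique, so `lerchPhi` does not depend on the choice. -/
theorem lerchPhi_eq {s v : ℂ} {F : ℂ → ℂ} (hF : IsLerchContinuation s v F) {z : ℂ}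
    (hz : z ∈ lerchDomain) : lerchPhi z s v = F z := by
  have hex : ∃ F, IsLerchContinuation s v F := ⟨F, hF⟩
  have hG := hex.choose_spec
  have hdef : lerchPhi z s v = hex.choose z := by simp only [lerchPhi, dif_pos hex]
  rw [hdef]
  have h0 : (0 : ℂ) ∈ lerchDomain := ball_subset_lerchDomain (by simp)
  refine (hG.1.analyticOnNhd lerchDomain_isOpen).eqOn_of_preconnected_of_eventuallyEq
    (hF.1.analyticOnNhd lerchDomain_isOpen) lerchDomain_isPreconnected h0 ?_ hz
  filter_upwards [Metric.ball_mem_nhds (0 : ℂ) one_pos] with w hw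
  have hw' : ‖w‖ < 1 := by simpa using hw
  exact (hG.2 w hw').unique (hF.2 w hw')

/-- The base point `z = e^{i(2πn+π)/l}` of the Lerch functions. -/
noncomputable def lerchBase (n l : ℂ) : ℂ :=
  Complex.exp (Complex.I * (2 * Real.pi * n + Real.pi) / l)

/-- The third Lerch argument `v = 1 - i l log a / (2π)`. -/
noncomputable def lerchShift (a l : ℂ) : ℂ :=
  1 - Complex.I * l * Complex.log a / (2 * Real.pi)

/-- The range of parameters: the strip of convergence of the integral, together with either
* `k` is a natural number (no branch of the power is involved) and `z ∉ [1, ∞)`, or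
* `k` is arbitrary, the principal argument of `a` lies in `[0, π]`, the singularity on the path of
  integration that occurs for `a > 0` is integrable, and `e^{i(2πn+π)/l}` is reached from
  the unit disc within the principal sheet `ℂ ∖ [1, ∞)`. For real `l` the last condition always
  holds in the strip. -/
def AdmissibleParams (a k l n : ℂ) : Prop :=
  a ≠ 0 ∧ 0 < (2 * n + 1).re ∧ (2 * n + 1).re < 2 * l.re ∧
    (((∃ N : ℕ, k = N) ∧ lerchBase n l ∈ lerchDomain) ∨
      (0 ≤ a.arg ∧ (a.arg = 0 → -1 < k.re) ∧
        (‖lerchBase n l‖ < 1 ∨ (0 < ((2 * n + 1) / l).re ∧ ((2 * n + 1) / l).re < 2))))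

/-! Put L = log a and c = 2n + 1. The substitution x = e^t turns the integral into ∫ E(t) t (L +
2t)^k dt over the real line, with E(t) = e^(ct) / (e^(2lt) - 1). The factor t, which is log x,
cancels the pole of E at 0. The poles of E in the upper half-plane are the positive multiples of τ =
πi/l, and E(t + τ) = z E(t), where z = e^(cτ) is the base point of the Lerch functions.

Let φ(t) = t (L + 2t)^k and raise the contour to the line Im t = Im τ / 2
(`HasDominatedBoundary.integral_regularKernel`). Write J(φ) for the integral of E φ there. Between
this line and its translate by τ lies the single pole τ, so J(φ) = z (τ φ(τ) + J(φ(· + τ)))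
(`midlineIntegral_eq_add`). After M iterations the remainder is z^M times a quantity of polynomial
growth in M. For |z| < 1 it vanishes in the limit, and J(φ) = ∑ z^(j+1) τ φ((j+1)τ). Since L +
2(j+1)τ = 2τ(v + j) and j + 1 = (v + j) + ilL/(2π), this series is z τ² (2τ)^k (Φ(z, -k-1, v) +
ilL/(2π) Φ(z, -k, v)).

For |z| ≥ 1 the identity is continued analytically in c over a convex open set containing c = l,
where z = -1 (`IsResidueCompatible.integral_of_continuation`). If k is a natural number, the Lerch
functions continue to ℂ ∖ {1}, and z ≠ 1 throughout the strip 0 < Re c < 2 Re l. Otherwise the strip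
is intersected with 0 < Re(c/l) < 2, which is mapped into the slit plane.

The condition arg a ≥ 0 keeps L + 2t in the upper half-plane, so that the principal power is
holomorphic and splits at the poles. If a > 0, then Re k > -1 makes the singularity at t = -L/2
integrable. -/

open Filter Topology

/-! ### Laplace transforms and Euler's integral -/

/-- The two-sided Laplace transform is holomorphic in the interior of its domain of absolute
convergence. -/
theorem differentiableAt_integral_cexp_mul {μ : Measure ℝ} {f : ℝ → ℂ} {I : Set ℝ} (hI : IsOpen I)
    (hf : ∀ r ∈ I, Integrable (fun t : ℝ => Complex.exp (r * t) * f t) μ) {c : ℂ}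
    (hc : c.re ∈ I) :
    DifferentiableAt ℂ (fun c : ℂ => ∫ t, Complex.exp (c * t) * f t ∂μ) c := by
  have hmeas : AEStronglyMeasurable f μ := by
    have h1 := (hf _ hc).aestronglyMeasurable
    have h2 : AEStronglyMeasurable (fun t : ℝ => Complex.exp (-(c.re * t))) μ :=
      (by fun_prop : Continuous fun t : ℝ => Complex.exp (-(c.re * t))).aestronglyMeasurable
    refine (h2.mul h1).congr (Eventually.of_forall fun t => ?_)
    simp only [Pi.mul_apply]
    rw [← mul_assoc, ← Complex.exp_add]
    simp
  have hmeas' : ∀ w : ℂ, AEStronglyMeasurable (fun t : ℝ => Complex.exp (w * t) * f t) μ :=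
    fun w => (by fun_prop : Continuous fun t : ℝ => Complex.exp (w * t)).aestronglyMeasurable.mul
      hmeas
  obtain ⟨ε, hε, hball⟩ := Metric.isOpen_iff.1 hI _ hc
  -- One δ covers the variation of `w`, a second absorbs the factor |t| produced by differentiation;
  -- 2δ < ε keeps both majorants inside `I`.
  set δ := ε / 3 with hδ
  have hδ0 : 0 < δ := by positivity
  have hp : c.re + 2 * δ ∈ I := hball (by
    simp only [Metric.mem_ball, Real.dist_eq, add_sub_cancel_left]
    rw [abs_of_pos (by positivity)]; linarith)
  have hm : c.re - 2 * δ ∈ I := hball (by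
    simp only [Metric.mem_ball, Real.dist_eq]
    rw [show c.re - 2 * δ - c.re = -(2 * δ) by ring, abs_neg, abs_of_pos (by positivity)]
    linarith)
  have hnorm : ∀ (r t : ℝ), ‖Complex.exp (r * t) * f t‖ = Real.exp (r * t) * ‖f t‖ := by
    intro r t
    rw [norm_mul, Complex.norm_exp]
    simp
  have hint : Integrable (fun t : ℝ => δ⁻¹ *
      (‖Complex.exp ((c.re + 2 * δ : ℝ) * t) * f t‖ +
        ‖Complex.exp ((c.re - 2 * δ : ℝ) * t) * f t‖)) μ :=
    ((hf _ hp).norm.add (hf _ hm).norm).const_mul _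
  have hbase : Integrable (fun t : ℝ => Complex.exp (c * t) * f t) μ := by
    refine (hf _ hc).mono (hmeas' c) (Eventually.of_forall fun t => ?_)
    rw [norm_mul, Complex.norm_exp, hnorm]
    simp
  refine (hasDerivAt_integral_of_dominated_loc_of_deriv_le
    (F' := fun (w : ℂ) (t : ℝ) => Complex.exp (w * t) * t * f t)
    (Metric.ball_mem_nhds c hδ0) (Eventually.of_forall hmeas') hbase ?_ ?_ hint
      ?_).2.differentiableAt
  · exact (by fun_prop : Continuous fun t : ℝ =>
      Complex.exp (c * t) * (t : ℂ)).aestronglyMeasurable.mul hmeas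
  · refine Eventually.of_forall fun t w hw => ?_
    rw [hnorm, hnorm, norm_mul, norm_mul, Complex.norm_exp, ← add_mul, ← mul_assoc]
    refine mul_le_mul_of_nonneg_right ?_ (norm_nonneg _)
    have hw' : |w.re - c.re| ≤ δ := by
      have := Complex.abs_re_le_norm (w - c)
      rw [Complex.sub_re] at this
      rw [Metric.mem_ball, dist_eq_norm] at hw
      linarith
    have hwt : (w * t).re = w.re * t := by simp
    have h1 : |t| ≤ δ⁻¹ * Real.exp (δ * |t|) := by
      rw [inv_mul_eq_div, le_div_iff₀ hδ0]
      have := Real.add_one_le_exp (δ * |t|)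
      linarith
    have h2 : Real.exp (w.re * t) ≤ Real.exp (c.re * t + δ * |t|) := by
      refine Real.exp_le_exp.2 ?_
      have : (w.re - c.re) * t ≤ δ * |t| := by
        refine (le_abs_self _).trans ?_
        rw [abs_mul]
        exact mul_le_mul_of_nonneg_right hw' (abs_nonneg _)
      linarith
    have h3 : Real.exp (c.re * t + δ * |t|) * Real.exp (δ * |t|) ≤
        Real.exp ((c.re + 2 * δ) * t) + Real.exp ((c.re - 2 * δ) * t) := by
      rw [← Real.exp_add]
      rcases abs_cases t with ⟨h, -⟩ | ⟨h, -⟩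
      · rw [h, show c.re * t + δ * t + δ * t = (c.re + 2 * δ) * t by ring]
        exact le_add_of_nonneg_right (Real.exp_pos _).le
      · rw [h, show c.re * t + δ * -t + δ * -t = (c.re - 2 * δ) * t by ring]
        exact le_add_of_nonneg_left (Real.exp_pos _).le
    rw [hwt, Complex.norm_real, Real.norm_eq_abs]
    calc Real.exp (w.re * t) * |t|
        ≤ Real.exp (c.re * t + δ * |t|) * (δ⁻¹ * Real.exp (δ * |t|)) := by gcongr
      _ = δ⁻¹ * (Real.exp (c.re * t + δ * |t|) * Real.exp (δ * |t|)) := by ring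
      _ ≤ _ := by gcongr
  · refine Eventually.of_forall fun t w _ => ?_
    have h := (((hasDerivAt_id w).mul_const (t : ℂ)).cexp).mul_const (f t)
    simpa using h

/-- The Gamma integral `∫ t^(s-1) e^(-rt) dt` converges absolutely for `Re r > 0`. -/
theorem integrableOn_cpow_mul_cexp_neg_mul {s r : ℂ} (hs : 0 < s.re) (hr : 0 < r.re) :
    IntegrableOn (fun t : ℝ => Complex.exp (-r * t) * (t : ℂ) ^ (s - 1)) (Ioi 0) := by
  have h := integrableOn_rpow_mul_exp_neg_mul_rpow (p := 1) (s := s.re - 1) (b := r.re)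
    (by linarith) one_pos hr
  refine Integrable.mono' h ?_ ?_
  · refine ContinuousOn.aestronglyMeasurable ?_ measurableSet_Ioi
    refine ContinuousOn.mul (by fun_prop) fun t ht => ?_
    refine ContinuousAt.continuousWithinAt ?_
    exact (Complex.continuousAt_ofReal_cpow_const t (s - 1) (Or.inr (ne_of_gt ht)))
  · filter_upwards [ae_restrict_mem measurableSet_Ioi] with t ht
    rw [norm_mul, Complex.norm_exp, Complex.norm_cpow_eq_rpow_re_of_pos ht, mul_comm]
    simp

/-- Euler's integral `∫ t^(s-1) e^(-rt) dt = r^(-s) Γ(s)` for complex `r`, `Re r > 0`. -/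
theorem integral_cexp_neg_mul_mul_cpow {s r : ℂ} (hs : 0 < s.re) (hr : 0 < r.re) :
    ∫ t : ℝ in Ioi 0, Complex.exp (-r * t) * (t : ℂ) ^ (s - 1) = r ^ (-s) * Complex.Gamma s := by
  set U : Set ℂ := {r : ℂ | 0 < r.re} with hU
  have hUo : IsOpen U := isOpen_lt continuous_const Complex.continuous_re
  have hUc : IsPreconnected U := (convex_halfSpace_re_gt 0).isPreconnected
  have hsp : ∀ w ∈ U, w ∈ Complex.slitPlane := fun w hw => Or.inl hw
  have hL : DifferentiableOn ℂ
      (fun r : ℂ => ∫ t : ℝ in Ioi 0, Complex.exp (-r * t) * (t : ℂ) ^ (s - 1)) U := by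
    intro w hw
    have h := differentiableAt_integral_cexp_mul (μ := volume.restrict (Ioi (0 : ℝ)))
      (f := fun t : ℝ => (t : ℂ) ^ (s - 1)) (I := Iio 0) isOpen_Iio (c := -w)
      (fun r hr => by
        have := integrableOn_cpow_mul_cexp_neg_mul (r := ((-r : ℝ) : ℂ)) hs
          (by simpa using hr)
        simpa [IntegrableOn] using this) (by simpa [hU] using hw)
    exact (DifferentiableAt.comp (f := fun w : ℂ => -w) w h
      differentiableAt_id.neg).differentiableWithinAt
  have hR : DifferentiableOn ℂ (fun r : ℂ => r ^ (-s) * Complex.Gamma s) U := fun w hw =>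
    (((differentiableAt_id).cpow_const (hsp w hw)).mul_const _).differentiableWithinAt
  refine (hL.analyticOnNhd hUo).eqOn_of_preconnected_of_frequently_eq (hR.analyticOnNhd hUo) hUc
    (z₀ := 1) (by simp [hU]) ?_ hr
  -- Real values of `r` accumulating at 1 suffice for the identity theorem, and for real `r` the
  -- formula is the classical Gamma integral.
  have htend : Tendsto (fun n : ℕ => (((1 : ℝ) + 1 / ((n : ℝ) + 1) : ℝ) : ℂ)) atTop (𝓝[≠] 1) := by
    refine tendsto_nhdsWithin_iff.2 ⟨?_, Eventually.of_forall fun n => ?_⟩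
    · have h := (tendsto_const_nhds (x := (1 : ℝ))).add
        (tendsto_one_div_add_atTop_nhds_zero_nat (𝕜 := ℝ))
      have := (Complex.continuous_ofReal.tendsto _).comp h
      simpa [Function.comp_def] using this
    · simp only [mem_compl_iff, mem_singleton_iff]
      intro h
      have h' : (1 : ℝ) + 1 / ((n : ℝ) + 1) = 1 := by exact_mod_cast h
      have : (0 : ℝ) < 1 / ((n : ℝ) + 1) := by positivity
      linarith
  refine htend.frequently (Eventually.of_forall fun n => ?_).frequently
  have hpos : (0 : ℝ) < 1 + 1 / ((n : ℝ) + 1) := by positivity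
  generalize (1 : ℝ) + 1 / ((n : ℝ) + 1) = x at hpos
  have h := Complex.integral_cpow_mul_exp_neg_mul_Ioi hs hpos
  have harg : (x : ℂ).arg ≠ Real.pi := by
    rw [Complex.arg_ofReal_of_nonneg hpos.le]
    exact Real.pi_pos.ne
  rw [one_div, Complex.inv_cpow _ _ harg, ← Complex.cpow_neg] at h
  rw [← h]
  refine setIntegral_congr_fun measurableSet_Ioi fun t _ => ?_
  simp only [neg_mul]
  ring

/-! ### Existence of the Lerch continuation -/

theorem one_sub_mul_ne_zero_of_mem_lerchDomain {z : ℂ} (hz : z ∈ lerchDomain) {x : ℝ}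
    (hx : x ∈ Icc (0 : ℝ) 1) : 1 - z * x ≠ 0 := by
  intro h
  have hx0 : x ≠ 0 := by
    rintro rfl
    simp at h
  have hxp : 0 < x := lt_of_le_of_ne hx.1 hx0.symm
  have hz' : z = ((x⁻¹ : ℝ) : ℂ) := by
    have : (x : ℂ) ≠ 0 := by exact_mod_cast hx0
    push_cast
    field_simp
    linear_combination -h
  have h1 : 1 ≤ x⁻¹ := (one_le_inv₀ hxp).2 hx.2
  rcases hz with h2 | h2
  · rw [hz', Complex.sub_re, Complex.ofReal_re, Complex.one_re] at h2
    linarith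
  · rw [hz', Complex.sub_im, Complex.ofReal_im, Complex.one_im] at h2
    simp at h2

/-- The Cauchy-type transform `∫ f(t) / (1 - z e^(-t)) dt` is holomorphic off `[1, ∞)`. -/
theorem differentiableOn_integral_mul_inv_one_sub {f : ℝ → ℂ} (hf : IntegrableOn f (Ioi 0)) :
    DifferentiableOn ℂ (fun z : ℂ => ∫ t : ℝ in Ioi 0, f t * (1 - z * (Real.exp (-t) : ℝ))⁻¹)
      lerchDomain := by
  intro z hz
  -- By compactness |1 - zx| has a positive minimum `m` on [0, 1]; at least m/2 of it survives for
  -- all `w` within m/2 of `z`, uniformly in `t`.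
  obtain ⟨x₀, hx₀, hmin⟩ := isCompact_Icc.exists_isMinOn (nonempty_Icc.2 (zero_le_one' ℝ))
    (by fun_prop : ContinuousOn (fun x : ℝ => ‖1 - z * (x : ℂ)‖) (Icc 0 1))
  set m := ‖1 - z * (x₀ : ℂ)‖ with hm
  have hm0 : 0 < m := norm_pos_iff.2 (one_sub_mul_ne_zero_of_mem_lerchDomain hz hx₀)
  have hlow : ∀ w ∈ Metric.ball z (m / 2), ∀ x ∈ Icc (0 : ℝ) 1, m / 2 ≤ ‖1 - w * (x : ℂ)‖ := by
    intro w hw x hx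
    have h1 : m ≤ ‖1 - z * (x : ℂ)‖ := hmin hx
    have h2 : ‖(w - z) * (x : ℂ)‖ ≤ m / 2 := by
      rw [norm_mul, Complex.norm_real, Real.norm_of_nonneg hx.1]
      rw [Metric.mem_ball, dist_eq_norm] at hw
      nlinarith [hx.2, hx.1, norm_nonneg (w - z)]
    have h3 := norm_sub_norm_le (1 - z * (x : ℂ)) ((w - z) * (x : ℂ))
    rw [show 1 - z * (x : ℂ) - (w - z) * x = 1 - w * x by ring] at h3
    linarith
  have hmem : ∀ t ∈ Ioi (0 : ℝ), Real.exp (-t) ∈ Icc (0 : ℝ) 1 := fun t ht =>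
    ⟨(Real.exp_pos _).le, Real.exp_le_one_iff.2 (by simpa using (mem_Ioi.1 ht).le)⟩
  have hmeas : ∀ w : ℂ, AEStronglyMeasurable
      (fun t : ℝ => (1 - w * (Real.exp (-t) : ℝ))⁻¹) (volume.restrict (Ioi 0)) := by
    intro w
    exact (by fun_prop : Measurable fun t : ℝ =>
      (1 - w * ((Real.exp (-t) : ℝ) : ℂ))⁻¹).aestronglyMeasurable
  have hinv : ∀ w ∈ Metric.ball z (m / 2), ∀ t ∈ Ioi (0 : ℝ),
      ‖(1 - w * ((Real.exp (-t) : ℝ) : ℂ))⁻¹‖ ≤ (m / 2)⁻¹ := by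
    intro w hw t ht
    rw [norm_inv]
    exact inv_anti₀ (by positivity) (hlow w hw _ (hmem t ht))
  have hzb : z ∈ Metric.ball z (m / 2) := Metric.mem_ball_self (by positivity)
  refine (hasDerivAt_integral_of_dominated_loc_of_deriv_le
    (F' := fun (w : ℂ) (t : ℝ) => f t * ((Real.exp (-t) : ℝ) *
      ((1 - w * ((Real.exp (-t) : ℝ) : ℂ))⁻¹ * (1 - w * ((Real.exp (-t) : ℝ) : ℂ))⁻¹)))
    (bound := fun t => ‖f t‖ * (1 * ((m / 2)⁻¹ * (m / 2)⁻¹)))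
    (Metric.ball_mem_nhds z (half_pos hm0))
    (Eventually.of_forall fun w => hf.aestronglyMeasurable.mul (hmeas w)) ?_ ?_ ?_
    (hf.norm.mul_const _) ?_).2.differentiableAt.differentiableWithinAt
  · refine (hf.norm.mul_const (m / 2)⁻¹).mono' (hf.aestronglyMeasurable.mul (hmeas z)) ?_
    filter_upwards [ae_restrict_mem measurableSet_Ioi] with t ht
    rw [Pi.mul_apply, norm_mul]
    exact mul_le_mul_of_nonneg_left (hinv z hzb t ht) (norm_nonneg _)
  · refine hf.aestronglyMeasurable.mul (AEStronglyMeasurable.mul ?_ ((hmeas z).mul (hmeas z)))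
    exact (by fun_prop : Continuous fun t : ℝ =>
      ((Real.exp (-t) : ℝ) : ℂ)).aestronglyMeasurable
  · filter_upwards [ae_restrict_mem measurableSet_Ioi] with t ht w hw
    have h1 := hinv w hw t ht
    have h2 : ‖((Real.exp (-t) : ℝ) : ℂ)‖ ≤ 1 := by
      rw [Complex.norm_real, Real.norm_of_nonneg (hmem t ht).1]
      exact (hmem t ht).2
    rw [norm_mul, norm_mul, norm_mul]
    gcongr
  · filter_upwards [ae_restrict_mem measurableSet_Ioi] with t ht w hw
    have hne : 1 - w * ((Real.exp (-t) : ℝ) : ℂ) ≠ 0 :=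
      norm_pos_iff.1 ((half_pos hm0).trans_le (hlow w hw _ (hmem t ht)))
    have h := ((((hasDerivAt_id w).mul_const ((Real.exp (-t) : ℝ) : ℂ)).const_sub 1).inv
      hne).const_mul (f t)
    refine h.congr_deriv ?_
    simp only [id]
    field_simp

/-- Holomorphic continuation to `U` of a power series converging on the unit disc. -/
def IsPowerSeriesContinuation (U : Set ℂ) (a : ℕ → ℂ) (F : ℂ → ℂ) : Prop :=
  DifferentiableOn ℂ F U ∧ ∀ z : ℂ, ‖z‖ < 1 → HasSum (fun j : ℕ => a j * z ^ j) (F z)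

theorem IsPowerSeriesContinuation.mono {U V : Set ℂ} {a : ℕ → ℂ} {F : ℂ → ℂ}
    (h : IsPowerSeriesContinuation U a F) (hVU : V ⊆ U) : IsPowerSeriesContinuation V a F :=
  ⟨h.1.mono hVU, h.2⟩

/-- The Euler operator `v + z d/dz` multiplies the coefficients by `v + j`. -/
theorem IsPowerSeriesContinuation.euler {U : Set ℂ} (hU : IsOpen U) {a : ℕ → ℂ} {F : ℂ → ℂ}
    (h : IsPowerSeriesContinuation U a F) (v : ℂ) :
    IsPowerSeriesContinuation U (fun j => (v + j) * a j) (fun z => v * F z + z * deriv F z) := by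
  refine ⟨(h.1.const_mul v).add (differentiableOn_id.mul (h.1.deriv hU)), fun z hz => ?_⟩
  obtain ⟨r, hzr, hr1⟩ := exists_between hz
  have hr0 : 0 ≤ r := (norm_nonneg z).trans hzr.le
  have hsum : Summable fun j : ℕ => ‖a j * (r : ℂ) ^ j‖ :=
    (h.2 (r : ℂ) (by rwa [Complex.norm_real, Real.norm_of_nonneg hr0])).summable.norm
  have hder := Complex.hasSum_deriv_of_summable_norm (F := fun (j : ℕ) (w : ℂ) => a j * w ^ j)
    (U := Metric.ball 0 r) (z := z) hsum (fun j => by fun_prop) Metric.isOpen_ball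
    (fun j w hw => by
      rw [norm_mul, norm_mul, norm_pow, norm_pow, Complex.norm_real, Real.norm_of_nonneg hr0]
      have : ‖w‖ ≤ r := by simpa using (mem_ball_zero_iff.1 hw).le
      gcongr) (by simpa using hzr)
  have heq : deriv (fun w : ℂ => ∑' j : ℕ, a j * w ^ j) z = deriv F z := by
    refine Filter.EventuallyEq.deriv_eq ?_
    filter_upwards [Metric.isOpen_ball.mem_nhds (by simpa using hz : z ∈ Metric.ball (0 : ℂ) 1)]
      with w hw
    exact (h.2 w (by simpa using hw)).tsum_eq
  rw [heq] at hder
  refine (((h.2 z hz).mul_left v).add (hder.mul_left z)).congr_fun ?_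
  intro j
  rcases j with _ | j
  · simp
  · simp
    ring

theorem isLerchContinuation_iff {s v : ℂ} {F : ℂ → ℂ} : IsLerchContinuation s v F ↔
    IsPowerSeriesContinuation lerchDomain (fun j => (v + j) ^ (-s)) F := Iff.rfl

/-- The continuation is Γ(s)⁻¹ ∫ t^(s-1) e^(-vt) / (1 - z e^(-t)) dt. On the disc, expand the
geometric series and integrate termwise with Euler's integral. -/
theorem exists_isLerchContinuation_of_re_pos {s v : ℂ} (hs : 0 < s.re) (hv : 0 < v.re) :
    ∃ F, IsLerchContinuation s v F := by
  set f : ℝ → ℂ := fun t => Complex.exp (-v * t) * (t : ℂ) ^ (s - 1) with hf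
  have hfi : IntegrableOn f (Ioi 0) := integrableOn_cpow_mul_cexp_neg_mul hs hv
  have hG : Complex.Gamma s ≠ 0 := Complex.Gamma_ne_zero_of_re_pos hs
  refine ⟨fun z => (Complex.Gamma s)⁻¹ *
    ∫ t : ℝ in Ioi 0, f t * (1 - z * (Real.exp (-t) : ℝ))⁻¹,
    (differentiableOn_integral_mul_inv_one_sub hfi).const_mul _, fun z hz => ?_⟩
  have hterm : ∀ (j : ℕ) (t : ℝ), f t * (z * ((Real.exp (-t) : ℝ) : ℂ)) ^ j =
      z ^ j * (Complex.exp (-(v + j) * t) * (t : ℂ) ^ (s - 1)) := by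
    intro j t
    have : Complex.exp (-(v + j) * t) =
        Complex.exp (-v * t) * ((Real.exp (-t) : ℝ) : ℂ) ^ j := by
      rw [Complex.ofReal_exp, ← Complex.exp_nat_mul, ← Complex.exp_add]
      congr 1
      push_cast
      ring
    rw [this, mul_pow, hf]
    ring
  have hvj : ∀ j : ℕ, 0 < (v + j).re := fun j => by
    rw [Complex.add_re, Complex.natCast_re]; positivity
  have hint : ∀ j : ℕ, IntegrableOn (fun t : ℝ => f t * (z * ((Real.exp (-t) : ℝ) : ℂ)) ^ j)
      (Ioi 0) := by
    intro j
    simp_rw [hterm]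
    exact (integrableOn_cpow_mul_cexp_neg_mul hs (hvj j)).const_mul _
  have hle : ∀ t ∈ Ioi (0 : ℝ), ‖z * ((Real.exp (-t) : ℝ) : ℂ)‖ ≤ ‖z‖ := by
    intro t ht
    rw [norm_mul, Complex.norm_real, Real.norm_of_nonneg (Real.exp_pos _).le]
    exact mul_le_of_le_one_right (norm_nonneg _)
      (Real.exp_le_one_iff.2 (by simpa using (mem_Ioi.1 ht).le))
  have hsum : Summable fun j : ℕ => ∫ t : ℝ in Ioi 0,
      ‖f t * (z * ((Real.exp (-t) : ℝ) : ℂ)) ^ j‖ := by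
    refine Summable.of_nonneg_of_le (fun j => integral_nonneg fun t => norm_nonneg _) (fun j => ?_)
      ((summable_geometric_of_lt_one (norm_nonneg z) hz).mul_right (∫ t : ℝ in Ioi 0, ‖f t‖))
    rw [← integral_const_mul]
    refine setIntegral_mono_on (hint j).norm (hfi.norm.const_mul _) measurableSet_Ioi fun t ht => ?_
    rw [norm_mul, norm_pow, mul_comm]
    exact mul_le_mul_of_nonneg_right (pow_le_pow_left₀ (norm_nonneg _) (hle t ht) j)
      (norm_nonneg _)
  have h := hasSum_integral_of_summable_integral_norm hint hsum
  have hR : ∫ t : ℝ in Ioi 0, ∑' j : ℕ, f t * (z * ((Real.exp (-t) : ℝ) : ℂ)) ^ j =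
      ∫ t : ℝ in Ioi 0, f t * (1 - z * (Real.exp (-t) : ℝ))⁻¹ := by
    refine setIntegral_congr_fun measurableSet_Ioi fun t ht => ?_
    rw [tsum_mul_left, tsum_geometric_of_norm_lt_one ((hle t ht).trans_lt hz)]
  rw [hR] at h
  refine (h.mul_left (Complex.Gamma s)⁻¹).congr_fun fun j => ?_
  rw [integral_congr_ae (Eventually.of_forall (hterm j)), integral_const_mul,
    integral_cexp_neg_mul_mul_cpow hs (hvj j)]
  field_simp

/-- The Euler operator v + z d/dz passes from s + 1 to s, so finitely many applications descend from
the half-plane Re s > 0 to any `s`. -/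
theorem exists_isLerchContinuation_of_shift_re_pos {v : ℂ} (hv : 0 < v.re) (s : ℂ) :
    ∃ F, IsLerchContinuation s v F := by
  obtain ⟨N, hN⟩ := exists_nat_gt (-s.re)
  induction N generalizing s with
  | zero => exact exists_isLerchContinuation_of_re_pos (by simpa using hN) hv
  | succ N ih =>
    obtain ⟨F, hF⟩ := ih (s + 1) (by
      push_cast at hN
      rw [Complex.add_re, Complex.one_re]
      linarith)
    rw [isLerchContinuation_iff] at hF
    refine ⟨fun z => v * F z + z * deriv F z, ?_⟩
    rw [isLerchContinuation_iff]
    convert hF.euler lerchDomain_isOpen v using 2 with j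
    have hne : v + j ≠ 0 := fun h0 => by
      have : 0 < (v + j).re := by rw [Complex.add_re, Complex.natCast_re]; positivity
      rw [h0] at this
      simp at this
    rw [show -s = 1 + -(s + 1) by ring, Complex.cpow_add _ _ hne, Complex.cpow_one]

/-- The Lerch function exists for all values of the parameters. -/
theorem exists_isLerchContinuation (s v : ℂ) : ∃ F, IsLerchContinuation s v F := by
  obtain ⟨N, hN⟩ := exists_nat_gt (-v.re)
  induction N generalizing v with
  | zero => exact exists_isLerchContinuation_of_shift_re_pos (by simpa using hN) s
  | succ N ih =>
    obtain ⟨F, hF⟩ := ih (v + 1) (by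
      push_cast at hN
      rw [Complex.add_re, Complex.one_re]
      linarith)
    -- Splitting off the term j = 0 leaves z times the series with shift v + 1, which moves `v` to
    -- the right until Re v > 0.
    refine ⟨fun z => v ^ (-s) + z * F z,
      (differentiableOn_const _).add (differentiableOn_id.mul hF.1), fun z hz => ?_⟩
    have h := (hF.2 z hz).mul_left z
    rw [← hasSum_nat_add_iff' 1]
    simp only [Finset.range_one, Finset.sum_singleton, Nat.cast_zero, add_zero, pow_zero, mul_one,
      add_sub_cancel_left]
    refine h.congr_fun fun j => ?_
    push_cast
    rw [show v + ((j : ℂ) + 1) = v + 1 + j by ring]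
    ring

/-- For polynomial coefficients `(v + j)^N` the continuation extends to `ℂ ∖ {1}`. -/
theorem exists_isPowerSeriesContinuation_natPow (v : ℂ) (N : ℕ) :
    ∃ F, IsPowerSeriesContinuation {1}ᶜ (fun j => (v + j) ^ N) F := by
  induction N with
  | zero =>
    refine ⟨fun z => (1 - z)⁻¹, fun z hz => ?_, fun z hz => ?_⟩
    · have : 1 - z ≠ 0 := sub_ne_zero.2 fun h => hz h.symm
      exact ((differentiableAt_const _).sub differentiableAt_id).inv
        this |>.differentiableWithinAt
    · simpa using hasSum_geometric_of_norm_lt_one hz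
  | succ N ih =>
    obtain ⟨F, hF⟩ := ih
    refine ⟨fun z => v * F z + z * deriv F z, ?_⟩
    convert hF.euler isOpen_compl_singleton v using 2 with j
    rw [pow_succ']

/-! ### Contour shifts in strips and exponential bounds -/

/-- Shifting a horizontal line of integration inside a strip of holomorphy. -/
theorem tendsto_intervalIntegral_sub_of_strip {G : ℂ → ℂ} {y₁ y₂ : ℝ} (hy : y₁ ≤ y₂)
    (hG : DifferentiableOn ℂ G {t : ℂ | t.im ∈ Icc y₁ y₂}) {B : ℝ → ℝ}
    (hB : Tendsto B atTop (𝓝 0))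
    (hb : ∀ᶠ R : ℝ in atTop, ∀ t : ℂ, t.im ∈ Icc y₁ y₂ → |t.re| = R → ‖G t‖ ≤ B R) :
    Tendsto (fun R : ℝ => (∫ x : ℝ in (-R)..R, G (x + y₁ * Complex.I)) -
      ∫ x : ℝ in (-R)..R, G (x + y₂ * Complex.I)) atTop (𝓝 0) := by
  have hlim : Tendsto (fun R => 2 * (B R * |y₂ - y₁|)) atTop (𝓝 0) := by
    simpa using (hB.mul_const |y₂ - y₁|).const_mul 2
  refine squeeze_zero_norm' ?_ hlim
  filter_upwards [hb, eventually_ge_atTop 0] with R hR hR0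
  have hrect := Complex.integral_boundary_rect_eq_zero_of_differentiableOn G
    (⟨-R, y₁⟩ : ℂ) (⟨R, y₂⟩ : ℂ) (hG.mono (by
      intro t ht
      simpa [uIcc_of_le hy] using ht.2))
  simp only at hrect
  have hside : ∀ x : ℝ, |x| = R →
      ‖∫ y : ℝ in y₁..y₂, G (x + y * Complex.I)‖ ≤ B R * |y₂ - y₁| := by
    intro x hx
    refine intervalIntegral.norm_integral_le_of_norm_le_const fun y hy' => hR _ ?_ ?_
    · rw [uIoc_of_le hy] at hy'
      simpa using ⟨hy'.1.le, hy'.2⟩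
    · simpa using hx
  have h1 := hside R (abs_of_nonneg hR0)
  have h2 := hside (-R) (by rw [abs_neg, abs_of_nonneg hR0])
  have heq : ((∫ x : ℝ in (-R)..R, G (x + y₁ * Complex.I)) -
      ∫ x : ℝ in (-R)..R, G (x + y₂ * Complex.I)) =
      Complex.I * (∫ y : ℝ in y₁..y₂, G (((-R : ℝ) : ℂ) + y * Complex.I)) -
      Complex.I * ∫ y : ℝ in y₁..y₂, G ((R : ℂ) + y * Complex.I) := by
    simp only [smul_eq_mul] at hrect
    linear_combination hrect
  rw [heq]
  refine (norm_sub_le _ _).trans ?_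
  rw [norm_mul, norm_mul, Complex.norm_I, one_mul, one_mul]
  linarith

/-- If both line integrals converge, a line of integration can be shifted in a strip of
holomorphy. -/
theorem integral_line_eq_of_strip {G : ℂ → ℂ} {y₁ y₂ : ℝ} (hy : y₁ ≤ y₂)
    (hG : DifferentiableOn ℂ G {t : ℂ | t.im ∈ Icc y₁ y₂}) {B : ℝ → ℝ}
    (hB : Tendsto B atTop (𝓝 0))
    (hb : ∀ᶠ R : ℝ in atTop, ∀ t : ℂ, t.im ∈ Icc y₁ y₂ → |t.re| = R → ‖G t‖ ≤ B R)
    (h₁ : Integrable fun x : ℝ => G (x + y₁ * Complex.I))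
    (h₂ : Integrable fun x : ℝ => G (x + y₂ * Complex.I)) :
    ∫ x : ℝ, G (x + y₁ * Complex.I) = ∫ x : ℝ, G (x + y₂ * Complex.I) := by
  have h := (intervalIntegral_tendsto_integral h₁ tendsto_neg_atTop_atBot tendsto_id).sub
    (intervalIntegral_tendsto_integral h₂ tendsto_neg_atTop_atBot tendsto_id)
  exact sub_eq_zero.1 (tendsto_nhds_unique h (tendsto_intervalIntegral_sub_of_strip hy hG hB hb))

/-- Lets a polynomial factor be paid for with part of the exponential decay of the kernel. -/
theorem exists_one_add_pow_le_exp (N : ℕ) {β : ℝ} (hβ : 0 < β) :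
    ∃ C : ℝ, 0 ≤ C ∧ ∀ u : ℝ, 0 ≤ u → (1 + u) ^ N ≤ C * Real.exp (β * u) := by
  -- N + 1 instead of N gives Nγ ≤ β and also covers N = 0.
  set γ := β / (N + 1) with hγ
  have hγ0 : 0 < γ := by positivity
  refine ⟨(1 + γ⁻¹) ^ N, by positivity, fun u hu => ?_⟩
  have h1 : 1 + u ≤ (1 + γ⁻¹) * Real.exp (γ * u) := by
    have h := Real.add_one_le_exp (γ * u)
    have h2 : (1 + γ⁻¹) * (γ * u + 1) = 1 + u + γ * u + γ⁻¹ := by field_simp; ring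
    have h3 : (1 + γ⁻¹) * (γ * u + 1) ≤ (1 + γ⁻¹) * Real.exp (γ * u) := by gcongr
    have : 0 < γ⁻¹ := by positivity
    nlinarith
  calc (1 + u) ^ N ≤ ((1 + γ⁻¹) * Real.exp (γ * u)) ^ N := by gcongr
    _ = (1 + γ⁻¹) ^ N * Real.exp (N * (γ * u)) := by rw [mul_pow, ← Real.exp_nat_mul]
    _ ≤ _ := by
      refine mul_le_mul_of_nonneg_left (Real.exp_le_exp.2 ?_) (by positivity)
      rw [← mul_assoc]
      refine mul_le_mul_of_nonneg_right ?_ hu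
      rw [hγ, ← mul_div_assoc, div_le_iff₀ (by positivity)]
      nlinarith

theorem integrable_abs_rpow_mul_exp_neg_mul_abs {s α : ℝ} (hs : -1 < s) (hα : 0 < α) :
    Integrable fun x : ℝ => |x| ^ s * Real.exp (-α * |x|) := by
  have h := integrableOn_rpow_mul_exp_neg_mul_rpow (p := 1) (s := s) (b := α) hs one_pos hα
  have h1 : IntegrableOn (fun x : ℝ => |x| ^ s * Real.exp (-α * |x|)) (Ioi 0) :=
    h.congr_fun (fun x hx => by simp only [abs_of_pos (mem_Ioi.1 hx), Real.rpow_one])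
      measurableSet_Ioi
  have h2 : IntegrableOn (fun x : ℝ => |x| ^ s * Real.exp (-α * |x|)) (Iic 0) := by
    rw [integrableOn_Iic_iff_integrableOn_Iio]
    have := IntegrableOn.comp_neg_Iio (c := 0)
      (f := fun x : ℝ => |x| ^ s * Real.exp (-α * |x|)) (by simpa using h1)
    simpa using this
  rw [← integrableOn_univ, ← Iic_union_Ioi (a := (0 : ℝ))]
  exact h2.union h1

theorem integrable_exp_neg_mul_abs {α : ℝ} (hα : 0 < α) :
    Integrable fun x : ℝ => Real.exp (-α * |x|) := by
  simpa using integrable_abs_rpow_mul_exp_neg_mul_abs (s := 0) (by norm_num) hα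

theorem integrable_one_add_abs_pow_mul_exp (N : ℕ) {α : ℝ} (hα : 0 < α) :
    Integrable fun x : ℝ => (1 + |x|) ^ N * Real.exp (-α * |x|) := by
  obtain ⟨C, hC0, hC⟩ := exists_one_add_pow_le_exp N (half_pos hα)
  refine ((integrable_exp_neg_mul_abs (half_pos hα)).const_mul C).mono'
    (by fun_prop : Continuous _).aestronglyMeasurable (Eventually.of_forall fun x => ?_)
  rw [Real.norm_of_nonneg (by positivity)]
  calc (1 + |x|) ^ N * Real.exp (-α * |x|)
      ≤ C * Real.exp (α / 2 * |x|) * Real.exp (-α * |x|) := by gcongr; exact hC _ (abs_nonneg x)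
    _ = C * Real.exp (-(α / 2) * |x|) := by
      rw [mul_assoc, ← Real.exp_add]
      ring_nf

theorem tendsto_one_add_pow_mul_exp (N : ℕ) {α : ℝ} (hα : 0 < α) :
    Tendsto (fun R : ℝ => (1 + R) ^ N * Real.exp (-α * R)) atTop (𝓝 0) := by
  obtain ⟨C, hC0, hC⟩ := exists_one_add_pow_le_exp N (half_pos hα)
  have hlim : Tendsto (fun R : ℝ => C * Real.exp (-(α / 2) * R)) atTop (𝓝 0) := by
    have : Tendsto (fun R : ℝ => -(α / 2) * R) atTop atBot :=
      tendsto_id.const_mul_atTop_of_neg (by linarith)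
    simpa using (Real.tendsto_exp_atBot.comp this).const_mul C
  refine squeeze_zero' ?_ ?_ hlim
  · filter_upwards [eventually_ge_atTop 0] with R hR
    positivity
  · filter_upwards [eventually_ge_atTop 0] with R hR
    calc (1 + R) ^ N * Real.exp (-α * R)
        ≤ C * Real.exp (α / 2 * R) * Real.exp (-α * R) := by gcongr; exact hC _ hR
      _ = C * Real.exp (-(α / 2) * R) := by
        rw [mul_assoc, ← Real.exp_add]
        ring_nf

/-! ### The kernel, its poles and its decay -/

/-- The kernel `e^(ct) / (e^(2lt) - 1)`. -/
noncomputable def bernoulliKernel (c l t : ℂ) : ℂ :=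
  Complex.exp (c * t) / (Complex.exp (2 * l * t) - 1)

/-- The spacing `πi / l` of the poles of `bernoulliKernel`. -/
noncomputable def polePeriod (l : ℂ) : ℂ := Real.pi * Complex.I / l

theorem ne_zero_of_re_pos {l : ℂ} (hl : 0 < l.re) : l ≠ 0 := by
  rintro rfl
  simp at hl

theorem polePeriod_im {l : ℂ} : (polePeriod l).im = Real.pi * l.re / Complex.normSq l := by
  rw [polePeriod, Complex.div_im]
  simp

theorem polePeriod_im_pos {l : ℂ} (hl : 0 < l.re) : 0 < (polePeriod l).im := by
  rw [polePeriod_im]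
  have := Complex.normSq_pos.2 (ne_zero_of_re_pos hl)
  have := Real.pi_pos
  positivity

theorem exp_two_mul_polePeriod {l : ℂ} (hl : 0 < l.re) :
    Complex.exp (2 * l * polePeriod l) = 1 := by
  have hl0 := ne_zero_of_re_pos hl
  rw [polePeriod, show 2 * l * (Real.pi * Complex.I / l) = 2 * Real.pi * Complex.I by
    field_simp, Complex.exp_two_pi_mul_I]

theorem exists_int_mul_polePeriod {l t : ℂ} (hl : 0 < l.re) (h : Complex.exp (2 * l * t) = 1) :
    ∃ m : ℤ, t = m * polePeriod l := by
  obtain ⟨m, hm⟩ := Complex.exp_eq_one_iff.1 h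
  refine ⟨m, ?_⟩
  have hl0 := ne_zero_of_re_pos hl
  rw [polePeriod]
  field_simp
  linear_combination hm / 2

/-- With 0 as the only pole in this strip, removing it makes the kernel holomorphic across the real
line. -/
theorem eq_zero_of_exp_two_mul_eq_one {l t : ℂ} (hl : 0 < l.re)
    (h : Complex.exp (2 * l * t) = 1) (h0 : -(polePeriod l).im < t.im)
    (h1 : t.im < (polePeriod l).im) : t = 0 := by
  obtain ⟨m, rfl⟩ := exists_int_mul_polePeriod hl h
  have hp := polePeriod_im_pos hl
  have him : ((m : ℂ) * polePeriod l).im = m * (polePeriod l).im := by simp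
  rw [him] at h0 h1
  have h2 : (m : ℝ) < 1 := by nlinarith
  have h3 : (-1 : ℝ) < m := by nlinarith
  have h2' : m < 1 := by exact_mod_cast h2
  have h3' : -1 < m := by exact_mod_cast h3
  have : m = 0 := by omega
  simp [this]

theorem eq_polePeriod_of_exp_two_mul_eq_one {l t : ℂ} (hl : 0 < l.re)
    (h : Complex.exp (2 * l * t) = 1) (h0 : 0 < t.im)
    (h1 : t.im < 2 * (polePeriod l).im) : t = polePeriod l := by
  have h2 : t - polePeriod l = 0 := by
    refine eq_zero_of_exp_two_mul_eq_one hl ?_ ?_ ?_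
    · rw [mul_sub, Complex.exp_sub, h, exp_two_mul_polePeriod hl, div_one]
    · rw [Complex.sub_im]; linarith
    · rw [Complex.sub_im]; linarith
  exact sub_eq_zero.1 h2

/-- This quasi-periodicity turns a shift of contour by one period into multiplication by z, and so
produces the powers of z in the residue series. -/
theorem bernoulliKernel_add_polePeriod {c l : ℂ} (hl : 0 < l.re) (t : ℂ) :
    bernoulliKernel c l (t + polePeriod l) =
      Complex.exp (c * polePeriod l) * bernoulliKernel c l t := by
  rw [bernoulliKernel, bernoulliKernel, mul_add, mul_add, Complex.exp_add, Complex.exp_add,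
    exp_two_mul_polePeriod hl]
  ring

/-- Exponential decay of the kernel in horizontal strips. -/
theorem exists_norm_bernoulliKernel_le {c l : ℂ} (hc : 0 < c.re) (hcl : c.re < 2 * l.re) (H : ℝ) :
    ∃ C R₀ α : ℝ, 0 ≤ C ∧ 0 < α ∧ ∀ t : ℂ, |t.im| ≤ H → R₀ ≤ |t.re| →
      ‖bernoulliKernel c l t‖ ≤ C * Real.exp (-α * |t.re|) := by
  have hl : 0 < l.re := by linarith
  -- `D` bounds the contribution of Im l to Re(2lt) in the strip. The threshold (D + 1)/(2 Re l)
  -- then forces |Re(2lt)| ≥ 1, so e^(2lt) stays away from 1.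
  set D := 2 * |l.im| * H with hD
  set α := min c.re (2 * l.re - c.re) with hα
  have hα0 : 0 < α := lt_min hc (by linarith)
  refine ⟨2 * Real.exp (|c.im| * H + D), (D + 1) / (2 * l.re), α, by positivity, hα0,
    fun t htH ht => ?_⟩
  have hRt : D + 1 ≤ 2 * l.re * |t.re| := by
    rw [div_le_iff₀ (by linarith)] at ht
    linarith
  have him : ∀ w : ℂ, |w.im * t.im| ≤ |w.im| * H := fun w => by
    rw [abs_mul]
    exact mul_le_mul_of_nonneg_left htH (abs_nonneg _)
  have hH0 : 0 ≤ H := (abs_nonneg _).trans htH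
  have hD0 : 0 ≤ D := by positivity
  have h1 : ‖Complex.exp (c * t)‖ ≤ Real.exp (c.re * t.re + |c.im| * H) := by
    rw [Complex.norm_exp, Complex.mul_re]
    refine Real.exp_le_exp.2 ?_
    have := (abs_le.1 (him c)).1
    linarith
  have h2re : (2 * l * t).re = 2 * l.re * t.re - 2 * (l.im * t.im) := by
    simp [Complex.mul_re]
    ring
  have hlim := abs_le.1 (him l)
  have hexp1 : (2 : ℝ) ≤ Real.exp 1 := by
    have := Real.add_one_le_exp 1
    linarith
  -- e^q / 2 is a lower bound for the denominator: to the right the exponential dominates, to the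
  -- left the constant 1 does, with q = 0. The two decay rates are 2 Re l - Re c and Re c.
  have hkey : ∃ q : ℝ, Real.exp q / 2 ≤ ‖Complex.exp (2 * l * t) - 1‖ ∧
      c.re * t.re - q ≤ -α * |t.re| + D := by
    rcases le_total 0 t.re with h0 | h0
    · rw [abs_of_nonneg h0] at hRt ⊢
      refine ⟨2 * l.re * t.re - D, ?_, ?_⟩
      · have hn : Real.exp (2 * l.re * t.re - D) ≤ ‖Complex.exp (2 * l * t)‖ := by
          rw [Complex.norm_exp, h2re]
          refine Real.exp_le_exp.2 ?_
          linarith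
        have h2 : 2 ≤ Real.exp (2 * l.re * t.re - D) :=
          hexp1.trans (Real.exp_le_exp.2 (by linarith))
        have h3 := norm_sub_norm_le (Complex.exp (2 * l * t)) 1
        rw [norm_one] at h3
        linarith
      · have : α * t.re ≤ (2 * l.re - c.re) * t.re :=
          mul_le_mul_of_nonneg_right (min_le_right _ _) h0
        linarith
    · rw [abs_of_nonpos h0] at hRt ⊢
      refine ⟨0, ?_, ?_⟩
      · have hn : ‖Complex.exp (2 * l * t)‖ ≤ 1 / 2 := by
          rw [Complex.norm_exp, h2re]
          have : Real.exp (2 * l.re * t.re - 2 * (l.im * t.im)) ≤ Real.exp (-1) :=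
            Real.exp_le_exp.2 (by linarith)
          refine this.trans ?_
          rw [Real.exp_neg, one_div]
          exact inv_anti₀ two_pos hexp1
        have h3 := norm_sub_norm_le 1 (Complex.exp (2 * l * t))
        rw [norm_one, norm_sub_rev] at h3
        rw [Real.exp_zero]
        linarith
      · have : α * -t.re ≤ c.re * -t.re :=
          mul_le_mul_of_nonneg_right (min_le_left _ _) (by linarith)
        linarith
  obtain ⟨q, hq1, hq2⟩ := hkey
  rw [bernoulliKernel, norm_div]
  calc ‖Complex.exp (c * t)‖ / ‖Complex.exp (2 * l * t) - 1‖
      ≤ Real.exp (c.re * t.re + |c.im| * H) / (Real.exp q / 2) := by gcongr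
    _ = 2 * Real.exp (c.re * t.re + |c.im| * H - q) := by
      rw [Real.exp_sub]
      field_simp
    _ ≤ 2 * Real.exp (|c.im| * H + D + -α * |t.re|) := by
      gcongr
      linarith
    _ = _ := by rw [Real.exp_add]; ring

/-- Exponential decay outside a compact part of a strip is exponential decay in the strip. -/
theorem exists_norm_le_exp_of_strip {g : ℂ → ℂ} {y₁ y₂ C R₀ α : ℝ} (hC : 0 ≤ C)
    (hg : ContinuousOn g {t : ℂ | t.im ∈ Icc y₁ y₂})
    (hb : ∀ t : ℂ, t.im ∈ Icc y₁ y₂ → R₀ ≤ |t.re| → ‖g t‖ ≤ C * Real.exp (-α * |t.re|)) :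
    ∃ C' : ℝ, 0 ≤ C' ∧ ∀ t : ℂ, t.im ∈ Icc y₁ y₂ → ‖g t‖ ≤ C' * Real.exp (-α * |t.re|) := by
  have hK : IsCompact (Icc (-R₀) R₀ ×ℂ Icc y₁ y₂) := isCompact_Icc.reProdIm isCompact_Icc
  have hcont : ContinuousOn (fun t : ℂ => ‖g t‖ * Real.exp (α * |t.re|))
      (Icc (-R₀) R₀ ×ℂ Icc y₁ y₂) :=
    (hg.mono fun t ht => ht.2).norm.mul (by fun_prop)
  obtain ⟨M, hM⟩ := hK.bddAbove_image hcont
  refine ⟨max C M, hC.trans (le_max_left _ _), fun t ht => ?_⟩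
  rcases le_total R₀ |t.re| with h | h
  · exact (hb t ht h).trans (by gcongr; exact le_max_left _ _)
  · have h1 : ‖g t‖ * Real.exp (α * |t.re|) ≤ M :=
      hM ⟨t, ⟨abs_le.1 h, ht⟩, rfl⟩
    have h2 : ‖g t‖ = ‖g t‖ * Real.exp (α * |t.re|) * Real.exp (-α * |t.re|) := by
      rw [mul_assoc, ← Real.exp_add]
      simp
    rw [h2]
    gcongr
    exact h1.trans (le_max_right _ _)

/-! ### Temperate functions and the residue expansion -/

/-- Holomorphic on the upper half-plane and of polynomial growth away from the real line. -/
structure IsTemperateUpper (φ : ℂ → ℂ) : Prop where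
  differentiableOn : DifferentiableOn ℂ φ {t : ℂ | 0 < t.im}
  growth : ∀ δ : ℝ, 0 < δ → ∃ (C : ℝ) (N : ℕ), 0 ≤ C ∧
    ∀ t : ℂ, δ ≤ t.im → ‖φ t‖ ≤ C * (1 + ‖t‖) ^ N

theorem IsTemperateUpper.comp_add {φ : ℂ → ℂ} (h : IsTemperateUpper φ) {w : ℂ} (hw : 0 ≤ w.im) :
    IsTemperateUpper fun t => φ (t + w) := by
  refine ⟨h.differentiableOn.comp (by fun_prop) fun t ht => ?_, fun δ hδ => ?_⟩
  · simp only [mem_ofPred_eq, Complex.add_im] at ht ⊢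
    linarith
  · obtain ⟨C, N, hC, hb⟩ := h.growth δ hδ
    refine ⟨C * (1 + ‖w‖) ^ N, N, by positivity, fun t ht => ?_⟩
    refine (hb _ (by rw [Complex.add_im]; linarith)).trans ?_
    rw [mul_assoc, ← mul_pow]
    gcongr
    have := norm_add_le t w
    nlinarith [norm_nonneg t, norm_nonneg w]

theorem one_add_norm_le_of_im {t : ℂ} {H : ℝ} (ht : |t.im| ≤ H) :
    1 + ‖t‖ ≤ (1 + H) * (1 + |t.re|) := by
  have h1 := Complex.norm_le_abs_re_add_abs_im t
  have h2 := abs_nonneg t.re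
  have h3 := (abs_nonneg _).trans ht
  nlinarith

/-- Controls the vertical sides of the rectangles in the contour shifts: exponential decay of the
kernel beats polynomial growth of `φ`. -/
theorem IsTemperateUpper.exists_tendsto_zero_bound {φ : ℂ → ℂ} (h : IsTemperateUpper φ) {c l : ℂ}
    (hc : 0 < c.re) (hcl : c.re < 2 * l.re) {y₁ y₂ : ℝ} (hy : 0 < y₁) :
    ∃ B : ℝ → ℝ, Tendsto B atTop (𝓝 0) ∧ ∀ᶠ R : ℝ in atTop, ∀ t : ℂ, t.im ∈ Icc y₁ y₂ →
      |t.re| = R → ‖bernoulliKernel c l t * φ t‖ ≤ B R := by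
  obtain ⟨C, R₀, α, hC, hα, hE⟩ := exists_norm_bernoulliKernel_le hc hcl y₂
  obtain ⟨D, N, hD, hφ⟩ := h.growth y₁ hy
  refine ⟨fun R => C * D * (1 + y₂) ^ N * ((1 + R) ^ N * Real.exp (-α * R)), ?_, ?_⟩
  · simpa using (tendsto_one_add_pow_mul_exp N hα).const_mul (C * D * (1 + y₂) ^ N)
  · filter_upwards [eventually_ge_atTop R₀] with R hR t ht htR
    have him : |t.im| ≤ y₂ := by
      rw [abs_of_nonneg (hy.le.trans ht.1)]
      exact ht.2
    have h1 := hE t him (by rwa [htR])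
    have h2 := hφ t ht.1
    have h3 := one_add_norm_le_of_im him
    rw [htR] at h1 h3
    rw [norm_mul]
    calc ‖bernoulliKernel c l t‖ * ‖φ t‖
        ≤ (C * Real.exp (-α * R)) * (D * ((1 + y₂) * (1 + R)) ^ N) := by
          refine mul_le_mul h1 (h2.trans ?_) (norm_nonneg _) (by positivity)
          gcongr
      _ = _ := by rw [mul_pow]; ring

theorem exp_two_mul_sub_one_ne_zero {l t : ℂ} (hl : 0 < l.re) (h0 : 0 < t.im)
    (h1 : t.im < 2 * (polePeriod l).im) (h : t ≠ polePeriod l) :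
    Complex.exp (2 * l * t) - 1 ≠ 0 := fun h2 =>
  h (eq_polePeriod_of_exp_two_mul_eq_one hl (sub_eq_zero.1 h2) h0 h1)

theorem differentiableAt_bernoulliKernel {c l t : ℂ} (h : Complex.exp (2 * l * t) - 1 ≠ 0) :
    DifferentiableAt ℂ (bernoulliKernel c l) t :=
  DifferentiableAt.div (c := fun t => Complex.exp (c * t))
    (d := fun t => Complex.exp (2 * l * t) - 1) (by fun_prop) (by fun_prop) h

/-- Uniform exponential bound for the kernel on a line between two rows of poles. -/
theorem exists_norm_bernoulliKernel_line_le {c l : ℂ} (hc : 0 < c.re) (hcl : c.re < 2 * l.re)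
    {y : ℝ} (hy : 0 < y) (hy' : y < (polePeriod l).im) :
    ∃ C α : ℝ, 0 ≤ C ∧ 0 < α ∧ ∀ x : ℝ,
      ‖bernoulliKernel c l (x + y * Complex.I)‖ ≤ C * Real.exp (-α * |x|) := by
  have hl : 0 < l.re := by linarith
  obtain ⟨C, R₀, α, hC, hα, hE⟩ := exists_norm_bernoulliKernel_le hc hcl y
  obtain ⟨C', hC', hb⟩ := exists_norm_le_exp_of_strip (g := bernoulliKernel c l) (y₁ := y)
    (y₂ := y) (R₀ := R₀) (α := α) hC (fun t ht => by
      have him : t.im = y := le_antisymm ht.2 ht.1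
      refine (differentiableAt_bernoulliKernel ?_).continuousAt.continuousWithinAt
      refine exp_two_mul_sub_one_ne_zero hl (by linarith) (by linarith) fun h => ?_
      rw [h] at him
      linarith) (fun t ht hR => hE t (by
        rw [abs_of_nonneg (hy.le.trans ht.1)]
        exact ht.2) hR)
  refine ⟨C', α, hC', hα, fun x => ?_⟩
  simpa using hb (x + y * Complex.I) (by simp)

theorem IsTemperateUpper.continuous_kernel_line {φ : ℂ → ℂ} (h : IsTemperateUpper φ) {c l : ℂ}
    (hl : 0 < l.re) {y : ℝ} (hy : 0 < y)
    (hy' : y < (polePeriod l).im) :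
    Continuous fun x : ℝ => bernoulliKernel c l (x + y * Complex.I) * φ (x + y * Complex.I) := by
  refine continuous_iff_continuousAt.2 fun x => ?_
  have him : ((x : ℂ) + y * Complex.I).im = y := by simp
  have hc1 : ContinuousAt (fun x : ℝ => (x : ℂ) + y * Complex.I) x := by fun_prop
  have hc2 : ContinuousAt (fun t => bernoulliKernel c l t * φ t) ((x : ℂ) + y * Complex.I) := by
    refine ContinuousAt.mul (differentiableAt_bernoulliKernel ?_).continuousAt
      (h.differentiableOn.differentiableAt ?_).continuousAt
    · refine exp_two_mul_sub_one_ne_zero hl (by linarith) (by linarith) fun h => ?_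
      rw [h] at him
      linarith
    · refine (isOpen_lt continuous_const Complex.continuous_im).mem_nhds ?_
      simpa using hy
  exact ContinuousAt.comp (f := fun x : ℝ => (x : ℂ) + y * Complex.I) hc2 hc1

theorem IsTemperateUpper.integrable_line {φ : ℂ → ℂ} (h : IsTemperateUpper φ) {c l : ℂ}
    (hc : 0 < c.re) (hcl : c.re < 2 * l.re) {y : ℝ} (hy : 0 < y) (hy' : y < (polePeriod l).im) :
    Integrable fun x : ℝ => bernoulliKernel c l (x + y * Complex.I) * φ (x + y * Complex.I) := by
  obtain ⟨C, α, hC, hα, hE⟩ := exists_norm_bernoulliKernel_line_le hc hcl hy hy'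
  obtain ⟨D, N, hD, hφ⟩ := h.growth y hy
  refine ((integrable_one_add_abs_pow_mul_exp N hα).const_mul (C * D * (1 + y) ^ N)).mono'
    (h.continuous_kernel_line (by linarith) hy hy').aestronglyMeasurable
    (Eventually.of_forall fun x => ?_)
  have h2 := hφ (x + y * Complex.I) (by simp)
  have h3 := one_add_norm_le_of_im (t := x + y * Complex.I) (H := y) (by simp [abs_of_pos hy])
  have hre : ((x : ℂ) + y * Complex.I).re = x := by simp
  rw [hre] at h3
  rw [norm_mul]
  calc ‖bernoulliKernel c l (x + y * Complex.I)‖ * ‖φ (x + y * Complex.I)‖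
      ≤ (C * Real.exp (-α * |x|)) * (D * ((1 + y) * (1 + |x|)) ^ N) := by
        refine mul_le_mul (hE x) (h2.trans ?_) (norm_nonneg _) (by positivity)
        gcongr
    _ = _ := by rw [mul_pow]; ring

/-- The integral of `bernoulliKernel c l * φ` along the line half-way to the first pole. -/
noncomputable def midlineIntegral (c l : ℂ) (φ : ℂ → ℂ) : ℂ :=
  ∫ x : ℝ, bernoulliKernel c l (x + ((polePeriod l).im / 2 : ℝ) * Complex.I) *
    φ (x + ((polePeriod l).im / 2 : ℝ) * Complex.I)

/-- These are the values of 1/(t - τ) on two lines at distance h below and above the pole. Neither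
is absolutely integrable, but their difference is 2hi/(u² + h²), a Poisson kernel. -/
theorem inv_sub_inv_line (u : ℝ) {h : ℝ} (hh : 0 < h) :
    ((u : ℂ) - h * Complex.I)⁻¹ - ((u : ℂ) + h * Complex.I)⁻¹ =
      ((2 * h⁻¹ * (1 + (u * h⁻¹) ^ 2)⁻¹ : ℝ) : ℂ) * Complex.I := by
  have h1 : (u : ℂ) - h * Complex.I ≠ 0 := fun h0 => by
    have := congrArg Complex.im h0
    simp at this
    linarith
  have h2 : (u : ℂ) + h * Complex.I ≠ 0 := fun h0 => by
    have := congrArg Complex.im h0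
    simp at this
    linarith
  have h3 : (h : ℂ) ≠ 0 := by exact_mod_cast hh.ne'
  have h4 : ((u : ℂ) - h * Complex.I) * ((u : ℂ) + h * Complex.I) = u ^ 2 + h ^ 2 := by
    linear_combination -(h : ℂ) ^ 2 * Complex.I_sq
  have h5 : (u : ℂ) ^ 2 + h ^ 2 ≠ 0 := h4 ▸ mul_ne_zero h1 h2
  rw [inv_sub_inv h1 h2, h4]
  push_cast
  have h6 : (1 : ℂ) + (u * (h : ℂ)⁻¹) ^ 2 = (u ^ 2 + h ^ 2) / h ^ 2 := by
    field_simp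
    ring
  rw [h6]
  field_simp
  ring

theorem integrable_inv_sub_inv_line (p : ℝ) {h : ℝ} (hh : 0 < h) :
    Integrable fun x : ℝ => (((x - p : ℝ) : ℂ) - h * Complex.I)⁻¹ -
      (((x - p : ℝ) : ℂ) + h * Complex.I)⁻¹ := by
  simp_rw [fun x : ℝ => inv_sub_inv_line (x - p) hh]
  refine Integrable.mul_const (Integrable.ofReal ?_) _
  refine Integrable.const_mul ?_ _
  exact ((integrable_inv_one_add_sq.comp_mul_right' (inv_ne_zero hh.ne')).comp_sub_right p)

theorem integral_inv_sub_inv_line (p : ℝ) {h : ℝ} (hh : 0 < h) :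
    ∫ x : ℝ, ((((x - p : ℝ) : ℂ) - h * Complex.I)⁻¹ - (((x - p : ℝ) : ℂ) + h * Complex.I)⁻¹) =
      2 * Real.pi * Complex.I := by
  simp_rw [fun x : ℝ => inv_sub_inv_line (x - p) hh]
  rw [integral_mul_const, integral_complex_ofReal, integral_const_mul,
    integral_sub_right_eq_self (fun x : ℝ => (1 + (x * h⁻¹) ^ 2)⁻¹) p,
    Measure.integral_comp_mul_right (fun x : ℝ => (1 + x ^ 2)⁻¹) h⁻¹,
    integral_univ_inv_one_add_sq, inv_inv, abs_of_pos hh, smul_eq_mul]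
  have h3 : (h : ℂ) ≠ 0 := by exact_mod_cast hh.ne'
  push_cast
  field_simp

/-- The residue of the kernel at the first pole. -/
theorem midlineIntegral_eq_add {φ : ℂ → ℂ} (h : IsTemperateUpper φ) {c l : ℂ}
    (hc : 0 < c.re) (hcl : c.re < 2 * l.re) :
    midlineIntegral c l φ = Complex.exp (c * polePeriod l) *
      (polePeriod l * φ (polePeriod l) +
        midlineIntegral c l fun t => φ (t + polePeriod l)) := by
  have hl : 0 < l.re := by linarith
  have hl0 := ne_zero_of_re_pos hl
  set τ := polePeriod l with hτ
  have hτ0 : 0 < τ.im := polePeriod_im_pos hl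
  set η := τ.im / 2 with hη
  have hη0 : 0 < η := by positivity
  set S : Set ℂ := {t : ℂ | t.im ∈ Ioo 0 (2 * τ.im)} with hS
  have hSo : IsOpen S := isOpen_Ioo.preimage Complex.continuous_im
  have hτS : τ ∈ S := ⟨hτ0, by linarith⟩
  set e : ℂ → ℂ := fun t => Complex.exp (2 * l * t) with he
  have heτ : e τ = 1 := exp_two_mul_polePeriod hl
  have hed : Differentiable ℂ e := by fun_prop
  have hde : deriv e τ = 2 * l := by
    have h1 : HasDerivAt e (Complex.exp (2 * l * τ) * (2 * l)) τ := by
      simpa using ((hasDerivAt_id τ).const_mul (2 * l)).cexp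
    rw [h1.deriv, exp_two_mul_polePeriod hl, one_mul]
  have hslope : ∀ t, t ≠ τ → dslope e τ t = (t - τ)⁻¹ * (Complex.exp (2 * l * t) - 1) := by
    intro t ht
    rw [dslope_of_ne _ ht, slope_def_module, heτ, smul_eq_mul]
  have hslope0 : ∀ t ∈ S, dslope e τ t ≠ 0 := by
    intro t ht
    by_cases h0 : t = τ
    · rw [h0, dslope_same, hde]
      exact mul_ne_zero two_ne_zero hl0
    · rw [hslope t h0]
      exact mul_ne_zero (inv_ne_zero (sub_ne_zero.2 h0))
        (exp_two_mul_sub_one_ne_zero hl ht.1 ht.2 h0)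
  -- `N` is (t - τ) times the integrand, extended holomorphically over τ, and r = N(τ) is the
  -- residue. Hence `dslope N τ` is the integrand minus r/(t - τ), holomorphic in the whole strip.
  set N : ℂ → ℂ := fun t => Complex.exp (c * t) / dslope e τ t * φ t with hN
  have hNd : DifferentiableOn ℂ N S := by
    refine DifferentiableOn.mul (DifferentiableOn.div (by fun_prop) ?_ hslope0)
      (h.differentiableOn.mono fun t ht => ht.1)
    exact (Complex.differentiableOn_dslope (hSo.mem_nhds hτS)).2 hed.differentiableOn
  have hGd : DifferentiableOn ℂ (dslope N τ) S :=
    (Complex.differentiableOn_dslope (hSo.mem_nhds hτS)).2 hNd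
  set r := N τ with hr
  have hrval : r = Complex.exp (c * τ) * φ τ / (2 * l) := by
    rw [hr, hN]
    simp only [dslope_same, hde]
    ring
  have hG : ∀ t, t ≠ τ → dslope N τ t = bernoulliKernel c l t * φ t - r * (t - τ)⁻¹ := by
    intro t ht
    have h1 : t - τ ≠ 0 := sub_ne_zero.2 ht
    have h2 : N t = (t - τ) * (bernoulliKernel c l t * φ t) := by
      simp only [hN, hslope t ht, bernoulliKernel]
      rw [div_mul_eq_div_div, div_inv_eq_mul]
      ring
    rw [dslope_of_ne _ ht, slope_def_module, smul_eq_mul, ← hr, h2, mul_sub, inv_mul_cancel_left₀ h1,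
      mul_comm r]
  obtain ⟨B, hB, hbB⟩ := h.exists_tendsto_zero_bound hc hcl (y₁ := η) (y₂ := 3 * η) hη0
  have hlim := tendsto_intervalIntegral_sub_of_strip (G := dslope N τ) (y₁ := η) (y₂ := 3 * η)
    (by linarith) (hGd.mono fun t ht => ⟨hη0.trans_le ht.1, by have := ht.2; linarith⟩)
    (B := fun R => B R + ‖r‖ * (R - |τ.re|)⁻¹) (by
      have h1 : Tendsto (fun R : ℝ => (R - |τ.re|)⁻¹) atTop (𝓝 0) :=
        tendsto_inv_atTop_zero.comp (tendsto_atTop_add_const_right _ _ tendsto_id)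
      simpa using hB.add (h1.const_mul ‖r‖)) (by
      filter_upwards [hbB, eventually_gt_atTop |τ.re|] with R hR hR' t ht htR
      have hre : R - |τ.re| ≤ ‖t - τ‖ := by
        have h1 := Complex.abs_re_le_norm (t - τ)
        rw [Complex.sub_re] at h1
        have h2 := abs_sub_abs_le_abs_sub t.re τ.re
        linarith
      have hne : t ≠ τ := by
        rintro rfl
        rw [sub_self, norm_zero] at hre
        linarith
      rw [hG t hne]
      refine (norm_sub_le _ _).trans (add_le_add (hR t ht htR) ?_)
      rw [norm_mul, norm_inv]
      gcongr)
  have hI₁ := h.integrable_line hc hcl hη0 (by linarith : η < τ.im)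
  have hI₂' := (h.comp_add hτ0.le).integrable_line hc hcl hη0 (by linarith : η < τ.im)
  have hτre : τ = (τ.re : ℂ) + ((2 * η : ℝ) : ℂ) * Complex.I := by
    apply Complex.ext <;> simp [hη]
    ring
  -- The upper line, at height 3η = η + Im τ, is the lower one translated by τ. The real part of τ
  -- becomes a translation of `x`, harmless under the integral.
  have hshift : ∀ x : ℝ, bernoulliKernel c l (x + (3 * η : ℝ) * Complex.I) *
      φ (x + (3 * η : ℝ) * Complex.I) = Complex.exp (c * τ) *
        (bernoulliKernel c l ((x - τ.re : ℝ) + η * Complex.I) *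
          φ ((x - τ.re : ℝ) + η * Complex.I + τ)) := by
    intro x
    have h1 : (x : ℂ) + (3 * η : ℝ) * Complex.I = ((x - τ.re : ℝ) + η * Complex.I) + τ := by
      conv_rhs => rw [hτre]
      push_cast
      simp
      ring
    rw [h1, bernoulliKernel_add_polePeriod hl]
    ring
  have hI₂ : Integrable fun x : ℝ => bernoulliKernel c l (x + (3 * η : ℝ) * Complex.I) *
      φ (x + (3 * η : ℝ) * Complex.I) := by
    simp_rw [hshift]
    exact (hI₂'.comp_sub_right τ.re).const_mul _
  have hval₂ : ∫ x : ℝ, bernoulliKernel c l (x + (3 * η : ℝ) * Complex.I) *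
      φ (x + (3 * η : ℝ) * Complex.I) = Complex.exp (c * τ) *
        midlineIntegral c l fun t => φ (t + τ) := by
    simp_rw [hshift]
    rw [integral_const_mul, integral_sub_right_eq_self (fun x : ℝ =>
      bernoulliKernel c l (x + η * Complex.I) * φ (x + η * Complex.I + τ)) τ.re]
    rfl
  have hI₃ := integrable_inv_sub_inv_line τ.re hη0
  -- The principal parts on the two lines are kept together, since only their difference is
  -- integrable over ℝ.
  have hlim' : Tendsto (fun R : ℝ =>
      (∫ x : ℝ in (-R)..R, (bernoulliKernel c l (x + η * Complex.I) * φ (x + η * Complex.I) -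
        bernoulliKernel c l (x + (3 * η : ℝ) * Complex.I) * φ (x + (3 * η : ℝ) * Complex.I) -
        r * ((((x - τ.re : ℝ) : ℂ) - η * Complex.I)⁻¹ -
          (((x - τ.re : ℝ) : ℂ) + η * Complex.I)⁻¹))) ) atTop (𝓝 0) := by
    refine hlim.congr fun R => ?_
    have hcont : ∀ y : ℝ, y ∈ Ioo 0 (2 * τ.im) →
        Continuous fun x : ℝ => dslope N τ (x + y * Complex.I) := fun y hy =>
      hGd.continuousOn.comp_continuous (by fun_prop) fun x => by simpa [hS] using hy
    rw [← intervalIntegral.integral_sub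
      ((hcont η ⟨hη0, by linarith⟩).intervalIntegrable _ _)
      ((hcont (3 * η) ⟨by linarith, by linarith⟩).intervalIntegrable _ _)]
    refine intervalIntegral.integral_congr fun x _ => ?_
    have hne : ∀ y : ℝ, y ≠ τ.im → (x : ℂ) + y * Complex.I ≠ τ := fun y hy h0 => hy (by
      simpa using congrArg Complex.im h0)
    rw [hG _ (hne η (by linarith)), hG _ (hne (3 * η) (by linarith))]
    have h1 : (x : ℂ) + η * Complex.I - τ = ((x - τ.re : ℝ) : ℂ) - η * Complex.I := by
      conv_lhs => rw [hτre]
      push_cast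
      ring
    have h2 : (x : ℂ) + (3 * η : ℝ) * Complex.I - τ =
        ((x - τ.re : ℝ) : ℂ) + η * Complex.I := by
      conv_lhs => rw [hτre]
      push_cast
      ring
    rw [h1, h2]
    ring
  have hfin := tendsto_nhds_unique hlim' (intervalIntegral_tendsto_integral
    ((hI₁.sub hI₂).sub (hI₃.const_mul r)) tendsto_neg_atTop_atBot tendsto_id)
  have hs₁ := integral_sub (hI₁.sub hI₂) (hI₃.const_mul r)
  have hs₂ := integral_sub hI₁ hI₂
  simp only [Pi.sub_apply] at hs₁
  rw [hs₁, hs₂, integral_const_mul,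
    integral_inv_sub_inv_line τ.re hη0, hval₂] at hfin
  have hK : midlineIntegral c l φ = ∫ x : ℝ, bernoulliKernel c l (x + η * Complex.I) *
      φ (x + η * Complex.I) := rfl
  rw [hK]
  -- The residue is e^(cτ) φ(τ)/(2l), and 2πi/(2l) = τ.
  have hτl : r * (2 * Real.pi * Complex.I) = Complex.exp (c * τ) * (τ * φ τ) := by
    rw [hrval, hτ, polePeriod]
    field_simp
  linear_combination -hfin + hτl

theorem midlineIntegral_eq_sum_add {φ : ℂ → ℂ} (h : IsTemperateUpper φ) {c l : ℂ}
    (hc : 0 < c.re) (hcl : c.re < 2 * l.re) (M : ℕ) :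
    midlineIntegral c l φ = (∑ j ∈ Finset.range M, Complex.exp (c * polePeriod l) ^ (j + 1) *
      (polePeriod l * φ ((j + 1) * polePeriod l))) + Complex.exp (c * polePeriod l) ^ M *
        midlineIntegral c l fun t => φ (t + M * polePeriod l) := by
  have hτ := polePeriod_im_pos (l := l) (by linarith)
  induction M with
  | zero => simp
  | succ M ih =>
    have hM : IsTemperateUpper fun t => φ (t + M * polePeriod l) :=
      h.comp_add (by simpa using by positivity)
    have hstep := midlineIntegral_eq_add hM hc hcl
    have h1 : (fun t => φ (t + polePeriod l + M * polePeriod l)) =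
        fun t => φ (t + (M + 1 : ℕ) * polePeriod l) := by
      funext t
      congr 1
      push_cast
      ring
    have h2 : polePeriod l + M * polePeriod l = (M + 1) * polePeriod l := by ring
    rw [h1, h2] at hstep
    rw [ih, hstep, Finset.sum_range_succ]
    ring

/-- On the fixed line, 1 + |t + Mτ| is at most a constant times (1 + |Re t|)(1 + M), so the
dependence on M factors out of the integral as a power. -/
theorem IsTemperateUpper.exists_norm_midlineIntegral_le {φ : ℂ → ℂ} (h : IsTemperateUpper φ)
    {c l : ℂ} (hc : 0 < c.re) (hcl : c.re < 2 * l.re) :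
    ∃ (C : ℝ) (N : ℕ), ∀ M : ℕ,
      ‖midlineIntegral c l fun t => φ (t + M * polePeriod l)‖ ≤ C * (1 + (M : ℝ)) ^ N := by
  have hτ := polePeriod_im_pos (l := l) (by linarith)
  set τ := polePeriod l with hτdef
  set η := τ.im / 2 with hη
  have hη0 : 0 < η := by positivity
  obtain ⟨C, α, hC, hα, hE⟩ := exists_norm_bernoulliKernel_line_le hc hcl hη0
    (by linarith : η < (polePeriod l).im)
  obtain ⟨D, N, hD, hφ⟩ := h.growth η hη0
  refine ⟨∫ x : ℝ, C * D * (1 + η + ‖τ‖) ^ N * ((1 + |x|) ^ N * Real.exp (-α * |x|)), N,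
    fun M => ?_⟩
  rw [← integral_mul_const]
  refine norm_integral_le_of_norm_le
    (((integrable_one_add_abs_pow_mul_exp N hα).const_mul _).mul_const _)
    (Eventually.of_forall fun x => ?_)
  have h2 := hφ (x + η * Complex.I + M * τ) (by
    simp
    positivity)
  have h3 := one_add_norm_le_of_im (t := x + η * Complex.I) (H := η) (by simp [abs_of_pos hη0])
  have hre : ((x : ℂ) + η * Complex.I).re = x := by simp
  rw [hre] at h3
  have h4 : 1 + ‖(x : ℂ) + η * Complex.I + M * τ‖ ≤
      (1 + η + ‖τ‖) * (1 + |x|) * (1 + (M : ℝ)) := by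
    have h5 := norm_add_le ((x : ℂ) + η * Complex.I) (M * τ)
    rw [norm_mul, Complex.norm_natCast] at h5
    have h6 : (0 : ℝ) ≤ M * ((1 + η) * (1 + |x|)) := by positivity
    have h7 : (0 : ℝ) ≤ ‖τ‖ * (1 + |x| + M * |x|) := by positivity
    nlinarith
  rw [norm_mul]
  calc ‖bernoulliKernel c l (x + η * Complex.I)‖ * ‖φ (x + η * Complex.I + M * τ)‖
      ≤ (C * Real.exp (-α * |x|)) * (D * ((1 + η + ‖τ‖) * (1 + |x|) * (1 + (M : ℝ))) ^ N) := by
        refine mul_le_mul (hE x) (h2.trans ?_) (norm_nonneg _) (by positivity)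
        gcongr
    _ = _ := by rw [mul_pow, mul_pow]; ring

/-- Residue expansion of the line integral when the geometric factor is contracting. -/
theorem IsTemperateUpper.tendsto_sum_midlineIntegral {φ : ℂ → ℂ} (h : IsTemperateUpper φ)
    {c l : ℂ} (hc : 0 < c.re) (hcl : c.re < 2 * l.re)
    (hz : ‖Complex.exp (c * polePeriod l)‖ < 1) :
    Tendsto (fun M : ℕ => ∑ j ∈ Finset.range M, Complex.exp (c * polePeriod l) ^ (j + 1) *
      (polePeriod l * φ ((j + 1) * polePeriod l))) atTop (𝓝 (midlineIntegral c l φ)) := by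
  obtain ⟨C, N, hb⟩ := h.exists_norm_midlineIntegral_le hc hcl
  set z := Complex.exp (c * polePeriod l) with hzdef
  have hz0 : 0 < ‖z‖ := norm_pos_iff.2 (Complex.exp_ne_zero _)
  have hrem : Tendsto (fun M : ℕ => z ^ M *
      midlineIntegral c l fun t => φ (t + M * polePeriod l)) atTop (𝓝 0) := by
    have hlim : Tendsto (fun M : ℕ => C * ‖z‖⁻¹ * (((M + 1 : ℕ) : ℝ) ^ N * ‖z‖ ^ (M + 1)))
        atTop (𝓝 0) := by
      have h1 := (tendsto_add_atTop_iff_nat 1).2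
        (tendsto_pow_const_mul_const_pow_of_lt_one N hz0.le hz)
      simpa using h1.const_mul (C * ‖z‖⁻¹)
    refine squeeze_zero_norm (fun M => ?_) hlim
    rw [norm_mul, norm_pow]
    calc ‖z‖ ^ M * ‖midlineIntegral c l fun t => φ (t + M * polePeriod l)‖
        ≤ ‖z‖ ^ M * (C * (1 + (M : ℝ)) ^ N) := by gcongr; exact hb M
      _ = _ := by
        rw [pow_succ]
        push_cast
        field_simp
        ring
  have h2 := (tendsto_const_nhds (x := midlineIntegral c l φ)).sub hrem
  rw [sub_zero] at h2
  refine h2.congr fun M => ?_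
  rw [midlineIntegral_eq_sum_add h hc hcl M]
  ring

/-- Supplies the factor t that comes from log x. -/
theorem IsTemperateUpper.id_mul {P : ℂ → ℂ} (h : IsTemperateUpper P) :
    IsTemperateUpper fun t => t * P t := by
  refine ⟨differentiableOn_id.mul h.differentiableOn, fun δ hδ => ?_⟩
  obtain ⟨C, N, hC, hb⟩ := h.growth δ hδ
  refine ⟨C, N + 1, hC, fun t ht => ?_⟩
  rw [norm_mul, pow_succ]
  calc ‖t‖ * ‖P t‖ ≤ (1 + ‖t‖) * (C * (1 + ‖t‖) ^ N) := by
        gcongr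
        · linarith
        · exact hb t ht
    _ = _ := by ring

/-! ### Boundary values on the real line -/

/-- A function of temperate growth in the upper half-plane with boundary values on the real line
that are attained in a dominated way. -/
structure HasDominatedBoundary (P : ℂ → ℂ) : Prop extends IsTemperateUpper P where
  measurable : AEStronglyMeasurable fun x : ℝ => P x
  dominated : ∃ b : ℝ → ℝ, (∀ α : ℝ, 0 < α → Integrable fun x : ℝ => b x * Real.exp (-α * |x|)) ∧
    ∀ᵐ x : ℝ, ∀ δ : ℝ, 0 < δ → δ < 1 → ‖P (x + δ * Complex.I)‖ ≤ b x
  boundary : ∀ᵐ x : ℝ, Tendsto (fun δ : ℝ => P (x + δ * Complex.I)) (𝓝[>] 0) (𝓝 (P x))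

/-- The kernel `t e^(ct) / (e^(2lt) - 1)` with its removable singularity at `0` removed. -/
noncomputable def regularKernel (c l t : ℂ) : ℂ :=
  Complex.exp (c * t) / dslope (fun t => Complex.exp (2 * l * t)) 0 t

theorem regularKernel_of_ne {c l t : ℂ} (ht : t ≠ 0) :
    regularKernel c l t = bernoulliKernel c l t * t := by
  rw [regularKernel, bernoulliKernel, dslope_of_ne _ ht, slope_def_module]
  simp only [mul_zero, Complex.exp_zero, sub_zero, smul_eq_mul]
  rw [div_mul_eq_div_div, div_inv_eq_mul]
  ring

theorem differentiableAt_regularKernel {c l t : ℂ} (hl : 0 < l.re)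
    (h0 : -(polePeriod l).im < t.im) (h1 : t.im < (polePeriod l).im) :
    DifferentiableAt ℂ (regularKernel c l) t := by
  have hed : Differentiable ℂ fun t : ℂ => Complex.exp (2 * l * t) := by fun_prop
  have hds : DifferentiableAt ℂ (dslope (fun t : ℂ => Complex.exp (2 * l * t)) 0) t :=
    ((Complex.differentiableOn_dslope univ_mem).2 hed.differentiableOn).differentiableAt univ_mem
  refine DifferentiableAt.div (c := fun t => Complex.exp (c * t)) (by fun_prop) hds ?_
  by_cases ht : t = 0
  · have h1 : HasDerivAt (fun t : ℂ => Complex.exp (2 * l * t)) (2 * l) 0 := by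
      simpa using ((hasDerivAt_id (0 : ℂ)).const_mul (2 * l)).cexp
    rw [ht, dslope_same, h1.deriv]
    exact mul_ne_zero two_ne_zero (ne_zero_of_re_pos hl)
  · rw [dslope_of_ne _ ht, slope_def_module]
    simp only [mul_zero, Complex.exp_zero, sub_zero, smul_eq_mul]
    exact mul_ne_zero (inv_ne_zero ht) (sub_ne_zero.2 fun h =>
      ht (eq_zero_of_exp_two_mul_eq_one hl h h0 h1))

theorem exists_norm_regularKernel_le {c l : ℂ} (hc : 0 < c.re) (hcl : c.re < 2 * l.re) {y : ℝ}
    (hy : 0 < y) (hy' : y < (polePeriod l).im) :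
    ∃ C α : ℝ, 0 ≤ C ∧ 0 < α ∧ ∀ t : ℂ, t.im ∈ Icc 0 y →
      ‖regularKernel c l t‖ ≤ C * Real.exp (-α * |t.re|) := by
  have hl : 0 < l.re := by linarith
  obtain ⟨C, R₀, α, hC, hα, hE⟩ := exists_norm_bernoulliKernel_le hc hcl y
  obtain ⟨D, hD, hDb⟩ := exists_one_add_pow_le_exp 1 (half_pos hα)
  obtain ⟨C', hC', hb⟩ := exists_norm_le_exp_of_strip (g := regularKernel c l) (y₁ := 0)
    -- The 1 keeps t away from 0, where the two kernels are related by division; half of the decay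
    -- rate absorbs the extra factor t.
    (y₂ := y) (R₀ := max R₀ 1) (α := α / 2) (C := C * (1 + y) * D) (by positivity) (fun t ht =>
      (differentiableAt_regularKernel hl (by linarith [ht.1]) (by
        linarith [ht.2])).continuousAt.continuousWithinAt) (fun t ht hR => by
      have ht0 : t ≠ 0 := by
        rintro rfl
        have := (le_max_right R₀ 1).trans hR
        simp at this
        linarith
      have him : |t.im| ≤ y := by
        rw [abs_of_nonneg ht.1]
        exact ht.2
      have h1 := hE t him ((le_max_left _ _).trans hR)
      have h2 := one_add_norm_le_of_im him
      have h3 := hDb |t.re| (abs_nonneg _)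
      rw [pow_one] at h3
      rw [regularKernel_of_ne ht0, norm_mul]
      calc ‖bernoulliKernel c l t‖ * ‖t‖
          ≤ (C * Real.exp (-α * |t.re|)) * ((1 + y) * (D * Real.exp (α / 2 * |t.re|))) := by
            refine mul_le_mul h1 ?_ (norm_nonneg _) (by positivity)
            refine (by linarith : ‖t‖ ≤ (1 + y) * (1 + |t.re|)).trans ?_
            gcongr
        _ = C * (1 + y) * D * (Real.exp (-α * |t.re|) * Real.exp (α / 2 * |t.re|)) := by ring
        _ = _ := by
          rw [← Real.exp_add]
          ring_nf)
  exact ⟨C', α / 2, hC', half_pos hα, hb⟩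

theorem HasDominatedBoundary.norm_le_of_bound {P : ℂ → ℂ} (h : HasDominatedBoundary P) {b : ℝ → ℝ}
    (hb : ∀ᵐ x : ℝ, ∀ δ : ℝ, 0 < δ → δ < 1 → ‖P (x + δ * Complex.I)‖ ≤ b x) :
    ∀ᵐ x : ℝ, ‖P x‖ ≤ b x := by
  filter_upwards [h.boundary, hb] with x hx hbx
  refine le_of_tendsto hx.norm ?_
  filter_upwards [Ioo_mem_nhdsGT (zero_lt_one' ℝ)] with δ hδ
  exact hbx δ hδ.1 hδ.2

theorem continuous_regularKernel_line {c l : ℂ} (hl : 0 < l.re) {y : ℝ} (hy : 0 ≤ y)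
    (hy' : y < (polePeriod l).im) :
    Continuous fun x : ℝ => regularKernel c l (x + y * Complex.I) := by
  refine continuous_iff_continuousAt.2 fun x => ?_
  have hc1 : ContinuousAt (fun x : ℝ => (x : ℂ) + y * Complex.I) x := by fun_prop
  have hc2 : ContinuousAt (regularKernel c l) ((x : ℂ) + y * Complex.I) :=
    (differentiableAt_regularKernel hl (by simp; linarith) (by simpa using hy')).continuousAt
  exact ContinuousAt.comp (f := fun x : ℝ => (x : ℂ) + y * Complex.I) hc2 hc1

theorem HasDominatedBoundary.integrable_regularKernel {P : ℂ → ℂ} (h : HasDominatedBoundary P)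
    {c l : ℂ} (hc : 0 < c.re) (hcl : c.re < 2 * l.re) :
    Integrable fun x : ℝ => regularKernel c l x * P x := by
  have hl : 0 < l.re := by linarith
  have hτ := polePeriod_im_pos hl
  obtain ⟨C, α, hC, hα, hE⟩ := exists_norm_regularKernel_le hc hcl (half_pos hτ) (by linarith)
  obtain ⟨b, hbi, hb⟩ := h.dominated
  have hcont := continuous_regularKernel_line (c := c) hl le_rfl hτ
  simp only [Complex.ofReal_zero, zero_mul, add_zero] at hcont
  refine ((hbi α hα).const_mul C).mono' (hcont.aestronglyMeasurable.mul h.measurable) ?_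
  filter_upwards [h.norm_le_of_bound hb] with x hx
  have h1 := hE x (by simpa using (half_pos hτ).le)
  rw [Complex.ofReal_re] at h1
  rw [norm_mul]
  calc ‖regularKernel c l x‖ * ‖P x‖ ≤ (C * Real.exp (-α * |x|)) * b x := by gcongr
    _ = _ := by ring

/-- No pole lies strictly between the real line and the midline, so the integral over Im t = δ does
not depend on small δ > 0. Dominated convergence as δ → 0 identifies it with the real integral. -/
theorem HasDominatedBoundary.integral_regularKernel {P : ℂ → ℂ} (h : HasDominatedBoundary P)
    {c l : ℂ} (hc : 0 < c.re) (hcl : c.re < 2 * l.re) :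
    ∫ x : ℝ, regularKernel c l x * P x = midlineIntegral c l fun t => t * P t := by
  have hl : 0 < l.re := by linarith
  have hτ := polePeriod_im_pos hl
  set η := (polePeriod l).im / 2 with hη
  have hη0 : 0 < η := by positivity
  have hητ : η < (polePeriod l).im := by linarith
  obtain ⟨C, α, hC, hα, hE⟩ := exists_norm_regularKernel_le hc hcl hη0 hητ
  obtain ⟨b, hbi, hb⟩ := h.dominated
  have hφ := h.toIsTemperateUpper.id_mul
  have hfun : ∀ δ : ℝ, 0 < δ → ∀ x : ℝ, regularKernel c l (x + δ * Complex.I) *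
      P (x + δ * Complex.I) = bernoulliKernel c l (x + δ * Complex.I) *
        ((x + δ * Complex.I) * P (x + δ * Complex.I)) := by
    intro δ hδ x
    rw [regularKernel_of_ne, mul_assoc]
    intro h0
    have := congrArg Complex.im h0
    simp at this
    linarith
  have hsmall : ∀ᶠ δ : ℝ in 𝓝[>] 0, 0 < δ ∧ δ < 1 ∧ δ < η := by
    filter_upwards [Ioo_mem_nhdsGT (lt_min one_pos hη0)] with δ hδ
    exact ⟨hδ.1, hδ.2.trans_le (min_le_left _ _), hδ.2.trans_le (min_le_right _ _)⟩
  have hconst : ∀ᶠ δ : ℝ in 𝓝[>] 0, midlineIntegral c l (fun t => t * P t) =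
      ∫ x : ℝ, regularKernel c l (x + δ * Complex.I) * P (x + δ * Complex.I) := by
    filter_upwards [hsmall] with δ hδ
    obtain ⟨hδ0, -, hδη⟩ := hδ
    simp_rw [hfun δ hδ0]
    obtain ⟨B, hB, hbB⟩ := hφ.exists_tendsto_zero_bound hc hcl (y₁ := δ) (y₂ := η) hδ0
    refine (integral_line_eq_of_strip (G := fun t => bernoulliKernel c l t * (t * P t))
      hδη.le (fun t ht => ?_) hB hbB
      (hφ.integrable_line hc hcl hδ0 (hδη.trans hητ)) (hφ.integrable_line hc hcl hη0 hητ)).symm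
    have ht0 : 0 < t.im := hδ0.trans_le ht.1
    have ht1 : t.im < (polePeriod l).im := ht.2.trans_lt hητ
    refine (DifferentiableAt.mul (differentiableAt_bernoulliKernel ?_)
      (hφ.differentiableOn.differentiableAt
        ((isOpen_lt continuous_const Complex.continuous_im).mem_nhds
          ht0))).differentiableWithinAt
    exact exp_two_mul_sub_one_ne_zero hl ht0 (by linarith) fun h0 => ht1.ne (by rw [h0])
  have hlim : Tendsto (fun δ : ℝ =>
      ∫ x : ℝ, regularKernel c l (x + δ * Complex.I) * P (x + δ * Complex.I)) (𝓝[>] 0)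
      (𝓝 (∫ x : ℝ, regularKernel c l x * P x)) := by
    refine tendsto_integral_filter_of_dominated_convergence
      (fun x => C * (b x * Real.exp (-α * |x|))) ?_ ?_ ((hbi α hα).const_mul C) ?_
    · filter_upwards [hsmall] with δ hδ
      have := hφ.continuous_kernel_line (c := c) hl hδ.1 (hδ.2.2.trans hητ)
      exact (this.congr fun x => (hfun δ hδ.1 x).symm).aestronglyMeasurable
    · filter_upwards [hsmall] with δ hδ
      filter_upwards [hb] with x hbx
      have h1 := hE (x + δ * Complex.I) (by simpa using ⟨hδ.1.le, hδ.2.2.le⟩)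
      have hre : ((x : ℂ) + δ * Complex.I).re = x := by simp
      rw [hre] at h1
      rw [norm_mul]
      calc ‖regularKernel c l (x + δ * Complex.I)‖ * ‖P (x + δ * Complex.I)‖
          ≤ (C * Real.exp (-α * |x|)) * b x := by
            gcongr
            exact hbx δ hδ.1 hδ.2.1
        _ = _ := by ring
    · filter_upwards [h.boundary] with x hx
      refine Tendsto.mul ?_ hx
      have h1 : ContinuousAt (regularKernel c l) (x : ℂ) :=
        (differentiableAt_regularKernel hl (by simpa using hτ) (by simpa using hτ)).continuousAt
      refine h1.tendsto.comp ?_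
      have h2 : Tendsto (fun δ : ℝ => (x : ℂ) + δ * Complex.I) (𝓝 0) (𝓝 x) := by
        have : Continuous fun δ : ℝ => (x : ℂ) + δ * Complex.I := by fun_prop
        simpa using this.tendsto 0
      exact h2.mono_left nhdsWithin_le_nhds
  exact tendsto_nhds_unique hlim ((tendsto_const_nhds).congr' hconst)

theorem one_add_norm_add_two_mul_le (L t : ℂ) :
    1 + ‖L + 2 * t‖ ≤ (3 + ‖L‖) * (1 + ‖t‖) := by
  have h := norm_add_le L (2 * t)
  rw [norm_mul, Complex.norm_ofNat] at h
  nlinarith [norm_nonneg L, norm_nonneg t]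

theorem one_add_norm_line_le (x : ℝ) {δ : ℝ} (h0 : 0 < δ) (h1 : δ < 1) :
    1 + ‖(x : ℂ) + δ * Complex.I‖ ≤ 2 * (1 + |x|) := by
  have h := one_add_norm_le_of_im (t := x + δ * Complex.I) (H := 1)
    (by simpa [abs_of_pos h0] using h1.le)
  have hre : ((x : ℂ) + δ * Complex.I).re = x := by simp
  rw [hre] at h
  linarith

/-- Polynomials in `t` have dominated boundary values. -/
theorem hasDominatedBoundary_natCast (L : ℂ) (N : ℕ) :
    HasDominatedBoundary fun t => (L + 2 * t) ^ (N : ℂ) := by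
  simp_rw [Complex.cpow_natCast]
  have hcont : Continuous fun t : ℂ => (L + 2 * t) ^ N := by fun_prop
  have hle : ∀ t : ℂ, ‖(L + 2 * t) ^ N‖ ≤ (3 + ‖L‖) ^ N * (1 + ‖t‖) ^ N := fun t => by
    rw [norm_pow, ← mul_pow]
    have := one_add_norm_add_two_mul_le L t
    gcongr
    linarith
  refine ⟨⟨by fun_prop, fun δ _ => ⟨(3 + ‖L‖) ^ N, N, by positivity, fun t _ => hle t⟩⟩,
    (hcont.comp Complex.continuous_ofReal).aestronglyMeasurable,
    ⟨fun x => (3 + ‖L‖) ^ N * 2 ^ N * (1 + |x|) ^ N, fun α hα => ?_,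
      Eventually.of_forall fun x δ h0 h1 => (hle _).trans ?_⟩, Eventually.of_forall fun x => ?_⟩
  · refine ((integrable_one_add_abs_pow_mul_exp N hα).const_mul ((3 + ‖L‖) ^ N * 2 ^ N)).congr
      (Eventually.of_forall fun x => ?_)
    simp only
    ring
  · beta_reduce
    rw [mul_assoc, ← mul_pow 2]
    have := one_add_norm_line_le x h0 h1
    gcongr
  · have h2 : Continuous fun δ : ℝ => (L + 2 * ((x : ℂ) + δ * Complex.I)) ^ N := by fun_prop
    have h3 := h2.tendsto 0
    simp only [Complex.ofReal_zero, zero_mul, add_zero] at h3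
    exact h3.mono_left nhdsWithin_le_nhds

theorem norm_cpow_le_exp_mul_rpow {w : ℂ} (hw : w ≠ 0) (k : ℂ) :
    ‖w ^ k‖ ≤ Real.exp (Real.pi * |k.im|) * ‖w‖ ^ k.re := by
  rw [Complex.norm_cpow_of_ne_zero hw, div_eq_mul_inv, ← Real.exp_neg, mul_comm]
  gcongr
  have h1 : |w.arg * k.im| ≤ Real.pi * |k.im| := by
    rw [abs_mul]
    exact mul_le_mul_of_nonneg_right (Complex.abs_arg_le_pi w) (abs_nonneg _)
  have := neg_le_of_abs_le h1
  linarith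

theorem rpow_le_one_add_pow_ceil {r s : ℝ} (hr : 0 ≤ r) (hs : 0 ≤ s) :
    r ^ s ≤ (1 + r) ^ ⌈s⌉₊ := by
  calc r ^ s ≤ (1 + r) ^ s := Real.rpow_le_rpow hr (by linarith) hs
    _ ≤ (1 + r) ^ (⌈s⌉₊ : ℝ) := Real.rpow_le_rpow_of_exponent_le (by linarith) (Nat.le_ceil s)
    _ = _ := Real.rpow_natCast _ _

/-- The principal logarithm is continuous on the punctured closed upper half-plane. -/
theorem continuousWithinAt_log_upper {w : ℂ} (hw : w ≠ 0) :
    ContinuousWithinAt Complex.log {z | 0 ≤ z.im} w := by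
  by_cases hs : w ∈ Complex.slitPlane
  · exact (continuousAt_clog hs).continuousWithinAt
  · rw [Complex.mem_slitPlane_iff, not_or, not_lt, not_not] at hs
    refine Complex.continuousWithinAt_log_of_re_neg_of_im_zero (lt_of_le_of_ne hs.1 fun h => hw ?_)
      hs.2
    exact Complex.ext h hs.2

/-- If Im L > 0 the base is bounded away from 0 by Im L. If L is real it vanishes at x = -L/2, and s
> -1 makes this singularity integrable. -/
theorem integrable_norm_add_two_mul_rpow {L : ℂ} {s : ℝ} (hL : 0 ≤ L.im)
    (hs : s < 0) (hLs : L.im = 0 → -1 < s) {α : ℝ} (hα : 0 < α) :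
    Integrable fun x : ℝ => ‖L + 2 * x‖ ^ s * Real.exp (-α * |x|) := by
  have hmeas : AEStronglyMeasurable fun x : ℝ => ‖L + 2 * x‖ ^ s * Real.exp (-α * |x|) := by
    refine Measurable.aestronglyMeasurable ?_
    fun_prop
  rcases hL.eq_or_lt with h | h
  · have hs1 := hLs h.symm
    have hint := ((integrable_abs_rpow_mul_exp_neg_mul_abs hs1 hα).comp_add_right
      (L.re / 2)).const_mul (2 ^ s * Real.exp (α * |L.re / 2|))
    refine hint.mono' hmeas (Eventually.of_forall fun x => ?_)
    have h1 : ‖L + 2 * x‖ = 2 * |x + L.re / 2| := by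
      have : L + 2 * x = ((2 * (x + L.re / 2) : ℝ) : ℂ) := by
        apply Complex.ext
        · simp
          ring
        · simp [← h]
      rw [this, Complex.norm_real, Real.norm_eq_abs, abs_mul, abs_two]
    rw [Real.norm_of_nonneg (by positivity), h1, Real.mul_rpow two_pos.le (abs_nonneg _)]
    have h2 : Real.exp (-α * |x|) ≤ Real.exp (α * |L.re / 2|) *
        Real.exp (-α * |x + L.re / 2|) := by
      rw [← Real.exp_add]
      refine Real.exp_le_exp.2 ?_
      nlinarith [abs_add_le x (L.re / 2)]
    calc 2 ^ s * |x + L.re / 2| ^ s * Real.exp (-α * |x|)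
        ≤ 2 ^ s * |x + L.re / 2| ^ s * (Real.exp (α * |L.re / 2|) *
          Real.exp (-α * |x + L.re / 2|)) := by gcongr
      _ = _ := by ring
  · refine ((integrable_exp_neg_mul_abs hα).const_mul (L.im ^ s)).mono' hmeas
      (Eventually.of_forall fun x => ?_)
    rw [Real.norm_of_nonneg (by positivity)]
    refine mul_le_mul_of_nonneg_right ?_ (Real.exp_pos _).le
    refine Real.rpow_le_rpow_of_nonpos h ?_ hs.le
    have := Complex.abs_im_le_norm (L + 2 * x)
    simp only [Complex.add_im, Complex.mul_im, Complex.re_ofNat, Complex.ofReal_im, mul_zero,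
      Complex.im_ofNat, zero_mul, add_zero] at this
    exact (le_abs_self _).trans this

/-- Principal powers of `L + 2t` with `Im L ≥ 0` have dominated boundary values, provided the
singularity on the real line, if there is one, is integrable. -/
theorem hasDominatedBoundary_cpow {L k : ℂ} (hL : 0 ≤ L.im) (hk : L.im = 0 → -1 < k.re) :
    HasDominatedBoundary fun t => (L + 2 * t) ^ k := by
  have him : ∀ t : ℂ, (L + 2 * t).im = L.im + 2 * t.im := fun t => by simp
  have hne : ∀ t : ℂ, 0 < t.im → L + 2 * t ≠ 0 := fun t ht h0 => by
    have h1 := congrArg Complex.im h0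
    rw [him, Complex.zero_im] at h1
    linarith
  have hae : ∀ᵐ x : ℝ, L + 2 * x ≠ 0 := by
    have : ∀ᵐ x : ℝ, x ≠ -L.re / 2 := by simp [ae_iff]
    filter_upwards [this] with x hx h0
    have h1 := congrArg Complex.re h0
    simp at h1
    exact hx (by linarith)
  have hE0 : 0 ≤ Real.exp (Real.pi * |k.im|) := (Real.exp_pos _).le
  have hpos : 0 ≤ k.re → ∀ t : ℂ, 0 < t.im → ‖(L + 2 * t) ^ k‖ ≤
      Real.exp (Real.pi * |k.im|) * (3 + ‖L‖) ^ ⌈k.re⌉₊ * (1 + ‖t‖) ^ ⌈k.re⌉₊ := by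
    intro hk0 t ht
    refine (norm_cpow_le_exp_mul_rpow (hne t ht) k).trans ?_
    rw [mul_assoc, ← mul_pow]
    gcongr
    refine (rpow_le_one_add_pow_ceil (norm_nonneg _) hk0).trans ?_
    gcongr
    exact one_add_norm_add_two_mul_le L t
  refine ⟨⟨fun t ht => ?_, fun δ hδ => ?_⟩, ?_, ?_, ?_⟩
  · refine DifferentiableAt.differentiableWithinAt ?_
    refine DifferentiableAt.cpow_const (by fun_prop) (Or.inr ?_)
    rw [him]
    have : 0 < t.im := ht
    exact ne_of_gt (by linarith)
  · rcases le_or_gt 0 k.re with hk0 | hk0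
    · exact ⟨_, ⌈k.re⌉₊, by positivity, fun t ht => hpos hk0 t (hδ.trans_le ht)⟩
    -- For Im t ≥ δ the base has modulus at least 2δ, so a negative power is bounded and degree 0
    -- suffices.
    · refine ⟨Real.exp (Real.pi * |k.im|) * (2 * δ) ^ k.re, 0, by positivity, fun t ht => ?_⟩
      rw [pow_zero, mul_one]
      refine (norm_cpow_le_exp_mul_rpow (hne t (hδ.trans_le ht)) k).trans ?_
      refine mul_le_mul_of_nonneg_left ?_ hE0
      refine Real.rpow_le_rpow_of_nonpos (by positivity) ?_ hk0.le
      have := (le_abs_self _).trans (Complex.abs_im_le_norm (L + 2 * t))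
      rw [him] at this
      linarith
  · refine Measurable.aestronglyMeasurable ?_
    fun_prop
  · rcases le_or_gt 0 k.re with hk0 | hk0
    · refine ⟨fun x => Real.exp (Real.pi * |k.im|) * (3 + ‖L‖) ^ ⌈k.re⌉₊ *
        (2 ^ ⌈k.re⌉₊ * (1 + |x|) ^ ⌈k.re⌉₊), fun α hα => ?_,
        Eventually.of_forall fun x δ h0 h1 => (hpos hk0 _ (by simpa using h0)).trans ?_⟩
      · refine ((integrable_one_add_abs_pow_mul_exp ⌈k.re⌉₊ hα).const_mul
          (Real.exp (Real.pi * |k.im|) * (3 + ‖L‖) ^ ⌈k.re⌉₊ * 2 ^ ⌈k.re⌉₊)).congr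
          (Eventually.of_forall fun x => ?_)
        simp only
        ring
      · beta_reduce
        rw [← mul_pow 2]
        have := one_add_norm_line_le x h0 h1
        gcongr
    -- Moving up from the real line increases |L + 2t| because Im L ≥ 0, so for Re k < 0 the modulus
    -- at the boundary gives the majorant.
    · refine ⟨fun x => Real.exp (Real.pi * |k.im|) * ‖L + 2 * x‖ ^ k.re, fun α hα => ?_, ?_⟩
      · simp_rw [mul_assoc]
        exact (integrable_norm_add_two_mul_rpow hL hk0 hk hα).const_mul _
      · filter_upwards [hae] with x hx δ h0 h1
        refine (norm_cpow_le_exp_mul_rpow (hne _ (by simpa using h0)) k).trans ?_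
        refine mul_le_mul_of_nonneg_left ?_ hE0
        refine Real.rpow_le_rpow_of_nonpos (norm_pos_iff.2 hx) ?_ hk0.le
        rw [Complex.norm_def, Complex.norm_def, Complex.normSq_apply, Complex.normSq_apply]
        refine Real.sqrt_le_sqrt ?_
        simp
        nlinarith
  · filter_upwards [hae] with x hx
    have hlim : Tendsto (fun δ : ℝ => L + 2 * ((x : ℂ) + δ * Complex.I)) (𝓝[>] 0)
        (𝓝 (L + 2 * x)) := by
      have h2 : Continuous fun δ : ℝ => L + 2 * ((x : ℂ) + δ * Complex.I) := by fun_prop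
      have h3 := h2.tendsto 0
      simp only [Complex.ofReal_zero, zero_mul, add_zero] at h3
      exact h3.mono_left nhdsWithin_le_nhds
    have hlim' : Tendsto (fun δ : ℝ => L + 2 * ((x : ℂ) + δ * Complex.I)) (𝓝[>] 0)
        (𝓝[{z | 0 ≤ z.im}] (L + 2 * x)) := by
      refine tendsto_nhdsWithin_iff.2 ⟨hlim, ?_⟩
      filter_upwards [self_mem_nhdsWithin] with δ hδ
      have : 0 < δ := hδ
      simp
      linarith
    have hlog := (continuousWithinAt_log_upper hx).tendsto.comp hlim'
    have hexp := (Complex.continuous_exp.tendsto _).comp (hlog.mul_const k)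
    rw [Complex.cpow_def_of_ne_zero hx]
    refine hexp.congr' ?_
    filter_upwards [self_mem_nhdsWithin] with δ hδ
    rw [Complex.cpow_def_of_ne_zero (hne _ (by simpa using hδ))]
    rfl

/-! ### Residues as Lerch coefficients and continuation in c -/

theorem two_mul_polePeriod_mul_shift {L l : ℂ} (hl : 0 < l.re) (j : ℕ) :
    2 * polePeriod l * (1 - Complex.I * l * L / (2 * Real.pi) + j) =
      L + 2 * ((j + 1) * polePeriod l) := by
  have hl0 := ne_zero_of_re_pos hl
  have hπ : (Real.pi : ℂ) ≠ 0 := by exact_mod_cast Real.pi_ne_zero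
  rw [polePeriod]
  field_simp
  linear_combination -(L * l) * Complex.I_sq

/-- The power of a product splits if the product and the first factor lie in the open upper
half-plane. -/
theorem mul_cpow_of_im_pos {A B : ℂ} (hA : 0 < A.im) (hAB : 0 < (A * B).im) (k : ℂ) :
    (A * B) ^ k = A ^ k * B ^ k := by
  have hA0 : A ≠ 0 := by rintro rfl; simp at hA
  have hAB0 : A * B ≠ 0 := fun h => by rw [h] at hAB; simp at hAB
  have hB0 : B ≠ 0 := right_ne_zero_of_mul hAB0
  have harg : ∀ w : ℂ, 0 < w.im → 0 < w.arg ∧ w.arg < Real.pi := by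
    intro w hw
    refine ⟨lt_of_le_of_ne (Complex.arg_nonneg_iff.2 hw.le) fun h => ?_,
      lt_of_le_of_ne (Complex.arg_le_pi w) fun h => ?_⟩
    · rw [(Complex.arg_eq_zero_iff.1 h.symm).2] at hw
      exact lt_irrefl _ hw
    · rw [(Complex.arg_eq_pi_iff.1 h).2] at hw
      exact lt_irrefl _ hw
  obtain ⟨h1, h2⟩ := harg A hA
  obtain ⟨h3, h4⟩ := harg (A * B) hAB
  have hinv : (A⁻¹).arg = -A.arg := by
    rw [Complex.arg_inv, if_neg h2.ne]
  have hlog : Complex.log B = Complex.log (A * B) - Complex.log A := by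
    have h := Complex.log_mul hAB0 (inv_ne_zero hA0) (by
      rw [hinv]
      constructor <;> linarith)
    rw [Complex.log_inv _ h2.ne, mul_comm A B, mul_inv_cancel_right₀ hA0] at h
    rw [h, mul_comm A B]
    ring
  rw [Complex.cpow_def_of_ne_zero hAB0, Complex.cpow_def_of_ne_zero hA0,
    Complex.cpow_def_of_ne_zero hB0, ← Complex.exp_add, hlog]
  congr 1
  ring

/-- The compatibilities between `L = log a`, `l`, and `k` under which the residues at the poles
`(j + 1) πi / l` are expressed by principal powers of `v + j`. -/
structure IsResidueCompatible (k l L : ℂ) : Prop where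
  boundary : HasDominatedBoundary fun t => (L + 2 * t) ^ k
  mul_cpow : ∀ j : ℕ, (L + 2 * ((j + 1) * polePeriod l)) ^ k =
    (2 * polePeriod l) ^ k * (1 - Complex.I * l * L / (2 * Real.pi) + j) ^ k
  cpow_succ : ∀ j : ℕ, (1 - Complex.I * l * L / (2 * Real.pi) + j) ^ (k + 1) =
    (1 - Complex.I * l * L / (2 * Real.pi) + j) *
      (1 - Complex.I * l * L / (2 * Real.pi) + j) ^ k

/-- Natural powers obey the power laws without branches, even when v + j = 0, so no condition on arg
a enters. -/
theorem isResidueCompatible_natCast {l : ℂ} (hl : 0 < l.re) (L : ℂ) (N : ℕ) :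
    IsResidueCompatible N l L := by
  refine ⟨hasDominatedBoundary_natCast L N, fun j => ?_, fun j => ?_⟩
  · rw [← two_mul_polePeriod_mul_shift hl, Complex.cpow_natCast, Complex.cpow_natCast,
      Complex.cpow_natCast, mul_pow]
  · rw [← Nat.cast_succ, Complex.cpow_natCast, Complex.cpow_natCast, pow_succ']

/-- Both 2τ and L + 2(j+1)τ = 2τ(v + j) lie in the open upper half-plane, which excludes a branch
jump and forces v + j ≠ 0. -/
theorem isResidueCompatible_of_im_nonneg {k l L : ℂ} (hl : 0 < l.re) (hL : 0 ≤ L.im)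
    (hk : L.im = 0 → -1 < k.re) : IsResidueCompatible k l L := by
  have hτ := polePeriod_im_pos hl
  have him : ∀ j : ℕ, 0 < (L + 2 * ((j + 1) * polePeriod l)).im := fun j => by
    simp
    positivity
  refine ⟨hasDominatedBoundary_cpow hL hk, fun j => ?_, fun j => ?_⟩
  · have h := him j
    rw [← two_mul_polePeriod_mul_shift hl] at h ⊢
    exact mul_cpow_of_im_pos (by simpa using hτ) h k
  · have hne : 1 - Complex.I * l * L / (2 * Real.pi) + j ≠ 0 := fun h0 => by
      have h := him j
      rw [← two_mul_polePeriod_mul_shift hl, h0] at h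
      simp at h
    rw [Complex.cpow_add _ _ hne, Complex.cpow_one, mul_comm]

/-- The log-integral as a residue series, for `‖e^(cπi/l)‖ < 1`. -/
theorem IsResidueCompatible.integral_of_norm_lt_one {k l L c : ℂ} (h : IsResidueCompatible k l L)
    (hc : 0 < c.re) (hcl : c.re < 2 * l.re) (hz : ‖Complex.exp (c * polePeriod l)‖ < 1)
    {S₀ S₁ : ℂ}
    (h₀ : HasSum (fun j : ℕ => (1 - Complex.I * l * L / (2 * Real.pi) + j) ^ k *
      Complex.exp (c * polePeriod l) ^ j) S₀)
    (h₁ : HasSum (fun j : ℕ => (1 - Complex.I * l * L / (2 * Real.pi) + j) ^ (k + 1) *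
      Complex.exp (c * polePeriod l) ^ j) S₁) :
    ∫ x : ℝ, regularKernel c l x * (L + 2 * x) ^ k = Complex.exp (c * polePeriod l) *
      (polePeriod l ^ 2 * (2 * polePeriod l) ^ k *
        (S₁ + Complex.I * l * L / (2 * Real.pi) * S₀)) := by
  rw [h.boundary.integral_regularKernel hc hcl]
  have hφ := h.boundary.toIsTemperateUpper.id_mul
  refine tendsto_nhds_unique (hφ.tendsto_sum_midlineIntegral hc hcl hz) ?_
  have hs := (((h₁.add (h₀.mul_left (Complex.I * l * L / (2 * Real.pi)))).mul_left
    (polePeriod l ^ 2 * (2 * polePeriod l) ^ k)).mul_left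
      (Complex.exp (c * polePeriod l))).tendsto_sum_nat
  refine hs.congr fun M => Finset.sum_congr rfl fun j _ => ?_
  rw [h.mul_cpow, h.cpow_succ, pow_succ]
  ring

/-- Analytic continuation of the residue series formula in the exponent `c`. -/
theorem IsResidueCompatible.integral_of_continuation {k l L : ℂ} (h : IsResidueCompatible k l L)
    (hl : 0 < l.re) {U S : Set ℂ} {F₀ F₁ : ℂ → ℂ}
    (h₀ : IsPowerSeriesContinuation U
      (fun j => (1 - Complex.I * l * L / (2 * Real.pi) + j) ^ k) F₀)
    (h₁ : IsPowerSeriesContinuation U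
      (fun j => (1 - Complex.I * l * L / (2 * Real.pi) + j) ^ (k + 1)) F₁)
    (hSo : IsOpen S) (hSc : Convex ℝ S) (hlS : l ∈ S)
    (hS : ∀ c ∈ S, 0 < c.re ∧ c.re < 2 * l.re)
    (hSU : ∀ c ∈ S, Complex.exp (c * polePeriod l) ∈ U) {c : ℂ} (hcS : c ∈ S) :
    ∫ x : ℝ, regularKernel c l x * (L + 2 * x) ^ k = Complex.exp (c * polePeriod l) *
      (polePeriod l ^ 2 * (2 * polePeriod l) ^ k *
        (F₁ (Complex.exp (c * polePeriod l)) +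
          Complex.I * l * L / (2 * Real.pi) * F₀ (Complex.exp (c * polePeriod l)))) := by
  have hker : ∀ (c : ℂ) (x : ℝ), regularKernel c l x * (L + 2 * x) ^ k =
      Complex.exp (c * x) * ((dslope (fun t => Complex.exp (2 * l * t)) 0 (x : ℂ))⁻¹ *
        (L + 2 * x) ^ k) := fun c x => by
    rw [regularKernel]
    ring
  have hexp : DifferentiableOn ℂ (fun c : ℂ => Complex.exp (c * polePeriod l)) S := by fun_prop
  have hLHS : DifferentiableOn ℂ
      (fun c : ℂ => ∫ x : ℝ, regularKernel c l x * (L + 2 * x) ^ k) S := by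
    intro w hw
    simp_rw [hker]
    refine (differentiableAt_integral_cexp_mul (I := Ioo 0 (2 * l.re)) isOpen_Ioo
      (fun r hr => ?_) (hS w hw)).differentiableWithinAt
    have := h.boundary.integrable_regularKernel (c := (r : ℂ)) (by simpa using hr.1)
      (by simpa using hr.2)
    simpa only [hker] using this
  have hRHS : DifferentiableOn ℂ (fun c : ℂ => Complex.exp (c * polePeriod l) *
      (polePeriod l ^ 2 * (2 * polePeriod l) ^ k *
        (F₁ (Complex.exp (c * polePeriod l)) +
          Complex.I * l * L / (2 * Real.pi) * F₀ (Complex.exp (c * polePeriod l))))) S :=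
    hexp.mul (((h₁.1.comp hexp hSU).add ((h₀.1.comp hexp hSU).const_mul _)).const_mul _)
  -- At c = l the base point is -1, on the unit circle; moving to c = l(1 + iε) multiplies its
  -- modulus by e^(-πε).
  have hbase : ∃ c₀ ∈ S, ‖Complex.exp (c₀ * polePeriod l)‖ < 1 := by
    have hcont : Tendsto (fun ε : ℝ => l * (1 + ε * Complex.I)) (𝓝[>] 0) (𝓝 l) := by
      have h1 : Continuous fun ε : ℝ => l * (1 + ε * Complex.I) := by fun_prop
      have h2 := h1.tendsto 0
      simp only [Complex.ofReal_zero, zero_mul, add_zero, mul_one] at h2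
      exact h2.mono_left nhdsWithin_le_nhds
    obtain ⟨ε, hεS, hε⟩ := ((hcont.eventually (hSo.mem_nhds hlS)).and self_mem_nhdsWithin).exists
    refine ⟨_, hεS, ?_⟩
    have hl0 := ne_zero_of_re_pos hl
    have h1 : l * (1 + ε * Complex.I) * polePeriod l =
        Real.pi * Complex.I - ((Real.pi * ε : ℝ) : ℂ) := by
      rw [polePeriod]
      push_cast
      field_simp
      linear_combination (ε : ℂ) * Complex.I_sq
    rw [h1, Complex.norm_exp, Real.exp_lt_one_iff]
    have : 0 < Real.pi * ε := mul_pos Real.pi_pos hε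
    simpa using this
  obtain ⟨c₀, hc₀S, hc₀⟩ := hbase
  refine (hLHS.analyticOnNhd hSo).eqOn_of_preconnected_of_eventuallyEq (hRHS.analyticOnNhd hSo)
    hSc.isPreconnected hc₀S ?_ hcS
  have hnorm : ∀ᶠ c : ℂ in 𝓝 c₀, ‖Complex.exp (c * polePeriod l)‖ < 1 := by
    have : Continuous fun c : ℂ => ‖Complex.exp (c * polePeriod l)‖ := by fun_prop
    exact this.tendsto c₀ |>.eventually_lt_const hc₀
  filter_upwards [hSo.mem_nhds hc₀S, hnorm] with w hw hwz
  exact h.integral_of_norm_lt_one (hS w hw).1 (hS w hw).2 hwz (h₀.2 _ hwz) (h₁.2 _ hwz)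

theorem lerchPhi_hasSum {s v z : ℂ} (hz : ‖z‖ < 1) :
    HasSum (fun j : ℕ => (v + j) ^ (-s) * z ^ j) (lerchPhi z s v) := by
  obtain ⟨F, hF⟩ := exists_isLerchContinuation s v
  rw [lerchPhi_eq hF (ball_subset_lerchDomain (by simpa using hz))]
  exact hF.2 z hz

/-- The exponent has imaginary part π Re w in (0, 2π). A real value requires Re w = 1, and then it
is negative. -/
theorem cexp_pi_mul_I_mul_mem_lerchDomain {w : ℂ} (h0 : 0 < w.re) (h2 : w.re < 2) :
    Complex.exp (Real.pi * Complex.I * w) ∈ lerchDomain := by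
  by_contra hnot
  have hnot' : ¬(0 < (1 - Complex.exp (Real.pi * Complex.I * w)).re ∨
      (1 - Complex.exp (Real.pi * Complex.I * w)).im ≠ 0) := hnot
  rw [not_or, not_lt, not_not, Complex.sub_re, Complex.sub_im, Complex.one_re, Complex.one_im,
    Complex.exp_re, Complex.exp_im] at hnot'
  have him : (Real.pi * Complex.I * w).im = Real.pi * w.re := by simp
  rw [him] at hnot'
  obtain ⟨hre, him0⟩ := hnot'
  have hE := Real.exp_pos (Real.pi * Complex.I * w).re
  have hsin : Real.sin (Real.pi * w.re) = 0 := by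
    rcases mul_eq_zero.1 (by linarith : Real.exp (Real.pi * Complex.I * w).re *
      Real.sin (Real.pi * w.re) = 0) with h | h
    · exact absurd h hE.ne'
    · exact h
  obtain ⟨m, hm⟩ := Real.sin_eq_zero_iff.1 hsin
  have hm' : (m : ℝ) = w.re :=
    mul_right_cancel₀ Real.pi_ne_zero (hm.trans (mul_comm _ _))
  rw [← hm'] at h0 h2
  have h0' : 0 < m := by exact_mod_cast h0
  have h2' : m < 2 := by exact_mod_cast h2
  have : m = 1 := by omega
  rw [← hm', this] at hre
  simp at hre
  have := Real.exp_pos (-(Real.pi * w.im))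
  linarith

theorem mul_polePeriod (c l : ℂ) : c * polePeriod l = Real.pi * Complex.I * (c / l) := by
  rw [polePeriod]
  ring

theorem lerchBase_eq (n l : ℂ) : lerchBase n l = Complex.exp ((2 * n + 1) * polePeriod l) := by
  rw [lerchBase, polePeriod]
  ring_nf

/-- The log-integral along the real line in terms of Lerch functions. -/
theorem integral_regularKernel_eq_lerchPhi {a k l n : ℂ} (h : AdmissibleParams a k l n) :
    IsResidueCompatible k l (Complex.log a) ∧
    ∫ x : ℝ, regularKernel (2 * n + 1) l x * (Complex.log a + 2 * x) ^ k =
      lerchBase n l * (polePeriod l ^ 2 * (2 * polePeriod l) ^ k *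
        (lerchPhi (lerchBase n l) (-k - 1) (lerchShift a l) +
          Complex.I * l * Complex.log a / (2 * Real.pi) *
            lerchPhi (lerchBase n l) (-k) (lerchShift a l))) := by
  obtain ⟨-, hc, hcl, hcases⟩ := h
  have hl : 0 < l.re := by linarith
  have hl0 := ne_zero_of_re_pos hl
  rw [lerchBase_eq] at hcases ⊢
  generalize 2 * n + 1 = c at *
  have hstrip : IsOpen {c : ℂ | 0 < c.re ∧ c.re < 2 * l.re} :=
    (isOpen_lt continuous_const Complex.continuous_re).inter
      (isOpen_lt Complex.continuous_re continuous_const)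
  have hstripc : Convex ℝ {c : ℂ | 0 < c.re ∧ c.re < 2 * l.re} :=
    (convex_halfSpace_re_gt 0).inter (convex_halfSpace_re_lt _)
  have hlstrip : l ∈ {c : ℂ | 0 < c.re ∧ c.re < 2 * l.re} := ⟨hl, by linarith⟩
  rcases hcases with ⟨⟨N, rfl⟩, hz⟩ | ⟨harg, hk, hz⟩
  · have hR := isResidueCompatible_natCast hl (Complex.log a) N
    refine ⟨hR, ?_⟩
    obtain ⟨F₀, hF₀⟩ := exists_isPowerSeriesContinuation_natPow (lerchShift a l) N
    obtain ⟨F₁, hF₁⟩ := exists_isPowerSeriesContinuation_natPow (lerchShift a l) (N + 1)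
    have hdom : lerchDomain ⊆ {1}ᶜ := fun w hw h1 => by
      rw [mem_singleton_iff.1 h1] at hw
      simp [lerchDomain] at hw
    simp_rw [← Complex.cpow_natCast] at hF₀ hF₁
    push_cast at hF₁
    rw [lerchPhi_eq (s := -(N : ℂ)) (F := F₀)
        (isLerchContinuation_iff.2 (by simpa using hF₀.mono hdom)) hz,
      lerchPhi_eq (F := F₁) (isLerchContinuation_iff.2 (by
        rw [show -(-(N : ℂ) - 1) = N + 1 by ring]
        exact hF₁.mono hdom)) hz]
    -- The strip may be mapped across [1, ∞) when l is not real, hence the continuation to ℂ ∖ {1}.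
    -- A base point 1 would mean c = 2ml with m an integer, and the strip would give 0 < m < 1.
    refine hR.integral_of_continuation hl hF₀ hF₁ hstrip hstripc hlstrip (fun c hc => hc)
      (fun c hc h1 => ?_) ⟨hc, hcl⟩
    rw [mem_singleton_iff, mul_polePeriod, Complex.exp_eq_one_iff] at h1
    obtain ⟨m, hm⟩ := h1
    have hπ : (Real.pi : ℂ) ≠ 0 := by exact_mod_cast Real.pi_ne_zero
    have hcm : c = ((2 * m : ℝ) : ℂ) * l := by
      have h2 : c / l = 2 * m :=
        mul_left_cancel₀ (mul_ne_zero hπ Complex.I_ne_zero) (by linear_combination hm)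
      rw [div_eq_iff hl0] at h2
      rw [h2]
      push_cast
      ring
    obtain ⟨h3, h4⟩ := hc
    rw [hcm, Complex.re_ofReal_mul] at h3 h4
    have h5 : (0 : ℝ) < m := by nlinarith
    have h6 : (m : ℝ) < 1 := by nlinarith
    have h5' : 0 < m := by exact_mod_cast h5
    have h6' : m < 1 := by exact_mod_cast h6
    omega
  · have hR : IsResidueCompatible k l (Complex.log a) :=
      isResidueCompatible_of_im_nonneg hl (by rwa [Complex.log_im])
        (fun h0 => hk (by rwa [Complex.log_im] at h0))
    refine ⟨hR, ?_⟩
    rcases hz with hz | ⟨hw0, hw2⟩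
    · have h₀ := lerchPhi_hasSum (s := -k) (v := lerchShift a l) hz
      have h₁ := lerchPhi_hasSum (s := -k - 1) (v := lerchShift a l) hz
      rw [neg_neg] at h₀
      rw [show -(-k - 1) = k + 1 by ring] at h₁
      exact hR.integral_of_norm_lt_one hc hcl hz h₀ h₁
    · obtain ⟨F₀, hF₀⟩ := exists_isLerchContinuation (-k) (lerchShift a l)
      obtain ⟨F₁, hF₁⟩ := exists_isLerchContinuation (-k - 1) (lerchShift a l)
      have hmem : ∀ w : ℂ, 0 < (w / l).re ∧ (w / l).re < 2 →
          Complex.exp (w * polePeriod l) ∈ lerchDomain := fun w hw => by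
        rw [mul_polePeriod]
        exact cexp_pi_mul_I_mul_mem_lerchDomain hw.1 hw.2
      rw [lerchPhi_eq hF₀ (hmem c ⟨hw0, hw2⟩), lerchPhi_eq hF₁ (hmem c ⟨hw0, hw2⟩)]
      rw [isLerchContinuation_iff, neg_neg] at hF₀
      rw [isLerchContinuation_iff, show -(-k - 1) = k + 1 by ring] at hF₁
      have hdiv : Continuous fun w : ℂ => (w / l).re := by fun_prop
      -- Here the continuation must stay on the principal sheet, so c moves in the intersection of
      -- two strips, still convex and still containing l.
      refine hR.integral_of_continuation hl hF₀ hF₁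
        (S := {c : ℂ | 0 < c.re ∧ c.re < 2 * l.re} ∩ {c : ℂ | 0 < (c / l).re ∧ (c / l).re < 2})
        (hstrip.inter ((isOpen_lt continuous_const hdiv).inter (isOpen_lt hdiv continuous_const)))
        (hstripc.inter ?_) ⟨hlstrip, ?_⟩ (fun w hw => hw.1) (fun w hw => hmem w hw.2)
        ⟨⟨hc, hcl⟩, hw0, hw2⟩
      · have hlin : IsLinearMap ℝ fun w : ℂ => (w / l).re :=
          ⟨fun x y => by rw [add_div, Complex.add_re], fun r x => by
            rw [smul_div_assoc, Complex.smul_re]⟩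
        exact (convex_halfSpace_gt hlin 0).inter (convex_halfSpace_lt hlin 2)
      · simp [div_self hl0]

/-! ### Return to the half-line -/

/-- Logarithmic substitution on the half-line. -/
theorem integrableOn_Ioi_and_integral_comp_exp {f g : ℝ → ℂ}
    (h : ∀ᵐ t : ℝ, (Real.exp t : ℂ) * f (Real.exp t) = g t) (hg : Integrable g) :
    IntegrableOn f (Ioi 0) ∧ ∫ x : ℝ in Ioi 0, f x = ∫ t : ℝ, g t := by
  have himg : Real.exp '' univ = Ioi 0 := by rw [image_univ, Real.range_exp]
  have hd : ∀ t ∈ univ, HasDerivWithinAt Real.exp (Real.exp t) univ t :=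
    fun t _ => (Real.hasDerivAt_exp t).hasDerivWithinAt
  have heq : ∀ᵐ t : ℝ, |Real.exp t| • f (Real.exp t) = g t := by
    filter_upwards [h] with t ht
    rw [← ht, abs_of_pos (Real.exp_pos t), Complex.real_smul, Complex.ofReal_exp]
  constructor
  · rw [← himg, integrableOn_image_iff_integrableOn_abs_deriv_smul MeasurableSet.univ hd
      Real.exp_injective.injOn, integrableOn_univ]
    exact hg.congr (heq.mono fun t ht => ht.symm)
  · rw [← himg, integral_image_eq_integral_abs_deriv_smul MeasurableSet.univ hd
      Real.exp_injective.injOn, setIntegral_univ]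
    exact integral_congr_ae heq

theorem cexp_mul_logIntegrand {a k l n : ℂ} (ha : a ≠ 0) {t : ℝ} (ht : t ≠ 0) :
    (Real.exp t : ℂ) * (((Real.exp t : ℝ) : ℂ) ^ (2 * n) * (Real.log (Real.exp t) : ℂ) *
      Complex.log (a * ((Real.exp t : ℝ) : ℂ) ^ 2) ^ k /
        (((Real.exp t : ℝ) : ℂ) ^ (2 * l) - 1)) =
      regularKernel (2 * n + 1) l t * (Complex.log a + 2 * t) ^ k := by
  have hpow : ∀ s : ℂ, ((Real.exp t : ℝ) : ℂ) ^ s = Complex.exp (s * t) := fun s => by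
    rw [Complex.cpow_def_of_ne_zero (by exact_mod_cast (Real.exp_pos t).ne'),
      ← Complex.ofReal_log (Real.exp_pos t).le, Real.log_exp, mul_comm]
  have hlog : Complex.log (a * ((Real.exp t : ℝ) : ℂ) ^ 2) = Complex.log a + 2 * t := by
    rw [← Complex.ofReal_pow, Complex.log_mul_ofReal _ (by positivity) _ ha, Real.log_pow,
      Real.log_exp]
    push_cast
    ring
  rw [hpow, hpow, hlog, Real.log_exp, regularKernel_of_ne (by exact_mod_cast ht), bernoulliKernel,
    add_mul (2 * n), Complex.exp_add, one_mul, Complex.ofReal_exp]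
  ring

/-- Positive real factors do not change the argument, so they always split off a principal power. -/
theorem two_mul_polePeriod_cpow (k l : ℂ) :
    (2 * polePeriod l) ^ k = (2 : ℂ) ^ k * (Real.pi : ℂ) ^ k * (Complex.I / l) ^ k := by
  have h2 : (2 : ℂ) = ((2 : ℝ) : ℂ) := by norm_num
  have hsplit : ∀ (r : ℝ) (w : ℂ), 0 < r → ((r : ℂ) * w) ^ k = (r : ℂ) ^ k * w ^ k := by
    intro r w hr
    by_cases hw : w = 0
    · by_cases hk : k = 0
      · simp [hk]
      · simp [hw, Complex.zero_cpow hk]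
    · have hr0 : (r : ℂ) ≠ 0 := by exact_mod_cast hr.ne'
      rw [Complex.cpow_def_of_ne_zero (mul_ne_zero hr0 hw), Complex.cpow_def_of_ne_zero hr0,
        Complex.cpow_def_of_ne_zero hw, Complex.log_ofReal_mul hr hw, ← Complex.exp_add,
        Complex.ofReal_log hr.le, add_mul]
  rw [polePeriod, mul_div_assoc, h2, hsplit _ _ two_pos, hsplit _ _ Real.pi_pos, mul_assoc]

/-- The integral of `x^(2n) log x log^k(a x²) / (x^(2l) - 1)` over the half-line. -/
theorem integral_log_mul_log_cpow_eq_lerchPhi {a k l n : ℂ} (h : AdmissibleParams a k l n) :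
    IntegrableOn (fun x : ℝ => (x : ℂ) ^ (2 * n) * (Real.log x : ℂ) *
      Complex.log (a * (x : ℂ) ^ 2) ^ k / ((x : ℂ) ^ (2 * l) - 1)) (Ioi 0) ∧
    ∫ x : ℝ in Ioi 0, (x : ℂ) ^ (2 * n) * (Real.log x : ℂ) *
        Complex.log (a * (x : ℂ) ^ 2) ^ k / ((x : ℂ) ^ (2 * l) - 1) =
      -((2 : ℂ) ^ (k - 1) * (Real.pi : ℂ) ^ (k + 1) * (Complex.I / l) ^ k *
          Complex.exp (Complex.I * (2 * Real.pi * n + Real.pi) / l) / l ^ 2) *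
        (2 * Real.pi * lerchPhi (lerchBase n l) (-k - 1) (lerchShift a l) +
          Complex.I * l * Complex.log a * lerchPhi (lerchBase n l) (-k) (lerchShift a l)) := by
  obtain ⟨hR, hval⟩ := integral_regularKernel_eq_lerchPhi h
  obtain ⟨ha, hc, hcl, -⟩ := h
  have hl0 := ne_zero_of_re_pos (l := l) (by linarith)
  have hπ : (Real.pi : ℂ) ≠ 0 := by exact_mod_cast Real.pi_ne_zero
  obtain ⟨h1, h2⟩ := integrableOn_Ioi_and_integral_comp_exp
    (f := fun x : ℝ => (x : ℂ) ^ (2 * n) * (Real.log x : ℂ) *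
      Complex.log (a * (x : ℂ) ^ 2) ^ k / ((x : ℂ) ^ (2 * l) - 1))
    (g := fun t : ℝ => regularKernel (2 * n + 1) l t * (Complex.log a + 2 * t) ^ k) (by
      -- At t = 0, that is x = 1, the quotient is 0/0 and takes the value 0, unlike the regularized
      -- kernel; the point is null.
      filter_upwards [(by simp [ae_iff] : ∀ᵐ t : ℝ, t ≠ 0)] with t ht
      exact_mod_cast cexp_mul_logIntegrand ha ht)
    (hR.boundary.integrable_regularKernel hc hcl)
  refine ⟨h1, ?_⟩
  rw [h2, hval, two_mul_polePeriod_cpow, polePeriod, Complex.cpow_sub _ _ two_ne_zero,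
    Complex.cpow_add _ _ hπ, Complex.cpow_one, Complex.cpow_one, ← lerchBase]
  field_simp
  linear_combination lerchBase n l * (Complex.I / l) ^ k *
    (2 * lerchPhi (lerchBase n l) (-k - 1) (lerchShift a l) * Real.pi +
    Complex.I * l * Complex.log a * lerchPhi (lerchBase n l) (-k) (lerchShift a l)) * Complex.I_sq

theorem mainTheorem9 (a k l : ℂ) :
    (∀ n : ℂ, AdmissibleParams a k l n →
      IntegrableOn (fun x : ℝ => (x : ℂ) ^ (2 * n) * (Real.log x : ℂ) *
          Complex.log (a * (x : ℂ) ^ 2) ^ k / ((x : ℂ) ^ (2 * l) - 1)) (Ioi 0) ∧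
      ∫ x : ℝ in Ioi 0, (x : ℂ) ^ (2 * n) * (Real.log x : ℂ) *
          Complex.log (a * (x : ℂ) ^ 2) ^ k / ((x : ℂ) ^ (2 * l) - 1) =
        -((2 : ℂ) ^ (k - 1) * (Real.pi : ℂ) ^ (k + 1) * (Complex.I / l) ^ k *
            Complex.exp (Complex.I * (2 * Real.pi * n + Real.pi) / l) / l ^ 2) *
          (2 * Real.pi * lerchPhi (lerchBase n l) (-k - 1) (lerchShift a l) +
            Complex.I * l * Complex.log a *
              lerchPhi (lerchBase n l) (-k) (lerchShift a l))) ∧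
    (∀ m n : ℂ, AdmissibleParams a k l m → AdmissibleParams a k l n →
      IntegrableOn (fun x : ℝ => (Real.log x : ℂ) * ((x : ℂ) ^ (2 * m) + (x : ℂ) ^ (2 * n)) *
          Complex.log (a * (x : ℂ) ^ 2) ^ k / ((x : ℂ) ^ (2 * l) - 1)) (Ioi 0) ∧
      ∫ x : ℝ in Ioi 0, (Real.log x : ℂ) * ((x : ℂ) ^ (2 * m) + (x : ℂ) ^ (2 * n)) *
          Complex.log (a * (x : ℂ) ^ 2) ^ k / ((x : ℂ) ^ (2 * l) - 1) =
        -((2 : ℂ) ^ (k - 1) * (Real.pi : ℂ) ^ (k + 1) *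
            Complex.exp (Complex.I * Real.pi / l) * (Complex.I / l) ^ k / l ^ 2) *
          (Complex.exp (2 * Complex.I * Real.pi * m / l) *
              (2 * Real.pi * lerchPhi (lerchBase m l) (-k - 1) (lerchShift a l) +
                Complex.I * l * Complex.log a *
                  lerchPhi (lerchBase m l) (-k) (lerchShift a l)) +
            Complex.exp (2 * Complex.I * Real.pi * n / l) *
              (2 * Real.pi * lerchPhi (lerchBase n l) (-k - 1) (lerchShift a l) +
                Complex.I * l * Complex.log a *
                  lerchPhi (lerchBase n l) (-k) (lerchShift a l)))) := by
  refine ⟨fun n hn => integral_log_mul_log_cpow_eq_lerchPhi hn, fun m n hm hn => ?_⟩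
  obtain ⟨hm1, hm2⟩ := integral_log_mul_log_cpow_eq_lerchPhi hm
  obtain ⟨hn1, hn2⟩ := integral_log_mul_log_cpow_eq_lerchPhi hn
  have hsplit : (fun x : ℝ => (Real.log x : ℂ) * ((x : ℂ) ^ (2 * m) + (x : ℂ) ^ (2 * n)) *
      Complex.log (a * (x : ℂ) ^ 2) ^ k / ((x : ℂ) ^ (2 * l) - 1)) = fun x : ℝ =>
      (x : ℂ) ^ (2 * m) * (Real.log x : ℂ) * Complex.log (a * (x : ℂ) ^ 2) ^ k /
        ((x : ℂ) ^ (2 * l) - 1) +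
      (x : ℂ) ^ (2 * n) * (Real.log x : ℂ) * Complex.log (a * (x : ℂ) ^ 2) ^ k /
        ((x : ℂ) ^ (2 * l) - 1) := by
    funext x
    ring
  have hexp : ∀ w : ℂ, Complex.exp (Complex.I * (2 * Real.pi * w + Real.pi) / l) =
      Complex.exp (Complex.I * Real.pi / l) * Complex.exp (2 * Complex.I * Real.pi * w / l) :=
    fun w => by
      rw [← Complex.exp_add]
      ring_nf
  rw [hsplit]
  refine ⟨hm1.add hn1, ?_⟩
  rw [integral_add hm1 hn1, hm2, hn2, hexp m, hexp n]
  ring
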